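/- Throughout, $K$ is prefix-free Kolmogorov complexity with respect to an optimal prefix-free machine, i.e. a partial computable function $\mathbb U$ from binary strings to binary strings with prefix-free domain such that for every partial computable $N$ from binary strings to binary strings with prefix-free domain there is $d$ with $K_{\mathbb U}(y)\le K_N(y)+d$ for all strings $y$, where $K_N(y)=\min\{|\sigma| : N(\sigma)=y\}$. Tuples of natural numbers are encoded effectively and injectively by binary strings. A function $\alpha:\mathbb N\to\mathbb N$ is $K$-trivial if there is $b$ such that $K(\alpha(0),\dots,\alpha(n-1))\le K(0^n)+b$ for all $n$ (this does not depend on the choice of $\mathbb U$). A computable metric space $\mathcal M=(M,d,(q_i)_{i\in\mathbb N})$ consists of a complete metric space $(M,d)$ and a dense sequence $(q_i)_{i\in\mathbb N}$ in $M$ without repetitions (the special points) such that $d(q_i,q_k)$ is a computable real uniformly in $i,k$. A Cauchy name for $x\in M$ is a function $\alpha:\mathbb N\to\mathbb N$ such that $d(q_{\alpha(s)},q_{\alpha(t)})\le 2^{-s}$ for all $t\ge s$ and $\lim_s q_{\alpha(s)}=x$. A point is computable if it has a computable Cauchy name, and $K$-trivial if it has a Cauchy name that is $K$-trivial as a function.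 The space is perfect if it has no isolated points. **Theorem.** Let $\mathcal M$ be a computable metric space that is perfect. Then for every special point $p\in M$ and every rational $\delta>0$ there exists a non-computable $K$-trivial point $x$ in the open ball $B(p,\delta)=\{y\in M : d(y,p)<\delta\}$. -/

import Mathlib

open Encodable

/-- A machine: a partial computable function from binary strings to binary strings.  It is
*prefix-free* if no string in its domain is a proper prefix of another string in its domain. -/
def IsPrefixFreeMachine (M : List Bool →. List Bool) : Prop :=
  Partrec M ∧ ∀ σ τ : List Bool, (M σ).Dom → (M τ).Dom → σ <+: τ → σ = τ

/-- `machineComplexity M y` is the length of a shortest `M`-description of `y`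
(`⊤` if there is no description). -/
noncomputable def machineComplexity (M : List Bool →. List Bool) (y : List Bool) : ℕ∞ :=
  ⨅ σ ∈ {σ : List Bool | y ∈ M σ}, (σ.length : ℕ∞)

/-- An optimal prefix-free machine: its descriptions are, up to an additive constant, at most as
long as those of any other prefix-free machine.  For such `U`, the prefix-free Kolmogorov
complexity `K` is `machineComplexity U`. -/
def IsOptimalPrefixFreeMachine (U : List Bool →. List Bool) : Prop :=
  IsPrefixFreeMachine U ∧
    ∀ M : List Bool →. List Bool, IsPrefixFreeMachine M →
      ∃ d : ℕ, ∀ y : List Bool, machineComplexity U y ≤ machineComplexity M y + d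

theorem exists_prefixFree_restriction (f : List Bool →. List Bool) (hf : Partrec f) :
    ∃ g : List Bool →. List Bool, IsPrefixFreeMachine g ∧
      ∀ τ y, y ∈ f τ → (∀ τ', (τ <+: τ' ∨ τ' <+: τ) → (f τ').Dom → τ' = τ) → y ∈ g τ := by
  classical
  obtain ⟨c, hc⟩ := Nat.Partrec.Code.exists_code.1 hf
  have hev : ∀ τ, c.eval (encode τ) = (f τ).map encode := by
    intro τ; rw [hc]; simp
  let bad : List Bool → ℕ → Prop := fun τ k =>
    ∃ m < k, ∃ τ' ∈ (decode m : Option (List Bool)), (τ <+: τ' ∨ τ' <+: τ) ∧ τ' ≠ τ ∧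
      (c.evaln k (encode τ')).isSome
  let s : List Bool → ℕ → Option (List Bool) := fun τ k =>
    if bad τ k then none else (c.evaln k (encode τ)).bind decode
  have hbad : PrimrecPred fun p : List Bool × ℕ => bad p.1 p.2 := by
    have hpre : PrimrecPred fun p : List Bool × List Bool => p.1 <+: p.2 := by
      refine ((Primrec.eq (α := List Bool)).comp
        (Primrec.list_take.comp (Primrec.list_length.comp Primrec.fst) Primrec.snd)
        Primrec.fst).of_eq fun p => ?_
      rw [List.prefix_iff_eq_take, eq_comm]
    have hev : Primrec fun p : (List Bool × ℕ) × List Bool => c.evaln p.1.2 (encode p.2) :=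
      Nat.Partrec.Code.primrec_evaln.comp
        (((Primrec.snd.comp Primrec.fst).pair (Primrec.const c)).pair
          (Primrec.encode.comp Primrec.snd))
    have h1 : PrimrecPred fun p : (List Bool × ℕ) × List Bool =>
        (p.1.1 <+: p.2 ∨ p.2 <+: p.1.1) ∧ p.2 ≠ p.1.1 ∧ (c.evaln p.1.2 (encode p.2)).isSome := by
      have ha : Primrec fun p : (List Bool × ℕ) × List Bool => p.1.1 := Primrec.fst.comp Primrec.fst
      refine PrimrecPred.and (PrimrecPred.or (hpre.comp (ha.pair Primrec.snd))
        (hpre.comp (Primrec.snd.pair ha))) (PrimrecPred.and ?_ ?_)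
      · exact ((Primrec.eq (α := List Bool)).comp Primrec.snd ha).not
      · exact ((Primrec.eq (α := Bool)).comp (Primrec.option_isSome.comp hev)
          (Primrec.const true))
    have h2 : PrimrecRel fun (τ' : List Bool) (p : List Bool × ℕ) =>
        (p.1 <+: τ' ∨ τ' <+: p.1) ∧ τ' ≠ p.1 ∧ (c.evaln p.2 (encode τ')).isSome :=
      h1.comp (Primrec.snd.pair Primrec.fst)
    have h3 := h2.exists_mem_list
    have h4 : Primrec fun p : List Bool × ℕ =>
        (List.range p.2).filterMap fun m => (decode m : Option (List Bool)) :=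
      Primrec.listFilterMap (Primrec.list_range.comp Primrec.snd)
        (Primrec.decode.comp Primrec.snd)
    refine (h3.comp h4 Primrec.id).of_eq fun p => ?_
    simp only [bad, List.mem_filterMap, List.mem_range, id]
    constructor
    · rintro ⟨τ', ⟨m, hm, h⟩, h'⟩
      exact ⟨m, hm, τ', h, h'⟩
    · rintro ⟨m, hm, τ', h, h'⟩
      exact ⟨τ', ⟨m, hm, h⟩, h'⟩
  have hs : Primrec₂ s := by
    refine Primrec.ite hbad (Primrec.const none) ?_
    refine Primrec.option_bind ?_ (Primrec.decode.comp Primrec.snd)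
    exact Nat.Partrec.Code.primrec_evaln.comp
      ((Primrec.snd.pair (Primrec.const c)).pair (Primrec.encode.comp Primrec.fst))
  have key : ∀ τ τ' k k', k ≤ k' → (s τ k).isSome → (s τ' k').isSome →
      (τ <+: τ' ∨ τ' <+: τ) → τ = τ' := by
    intro τ τ' k k' hk h h' hc'
    by_contra hne
    have hnb : ¬ bad τ' k' := by
      intro hb; simp [s, hb] at h'
    apply hnb
    have hnb' : ¬ bad τ k := by
      intro hb; simp [s, hb] at h
    simp only [s, hnb', if_false] at h
    obtain ⟨y, hy⟩ := Option.isSome_iff_exists.1 h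
    obtain ⟨n, hn, -⟩ := Option.bind_eq_some_iff.1 hy
    have hn' := Nat.Partrec.Code.evaln_mono hk hn
    refine ⟨encode τ, Nat.Partrec.Code.evaln_bound hn', τ, by simp, hc'.symm, hne, ?_⟩
    exact Option.isSome_iff_exists.2 ⟨n, hn'⟩
  refine ⟨fun τ => Nat.rfindOpt (s τ), ⟨Partrec.rfindOpt hs.to_comp, ?_⟩, ?_⟩
  · intro σ τ h h' hp
    obtain ⟨k, y, hy⟩ := Nat.rfindOpt_dom.1 h
    obtain ⟨k', y', hy'⟩ := Nat.rfindOpt_dom.1 h'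
    have hy2 := Option.isSome_iff_exists.2 ⟨y, hy⟩
    have hy2' := Option.isSome_iff_exists.2 ⟨y', hy'⟩
    rcases le_total k k' with hk | hk
    · exact key _ _ _ _ hk hy2 hy2' (Or.inl hp)
    · exact (key _ _ _ _ hk hy2' hy2 (Or.inr hp)).symm
  · intro τ y hy huniq
    have hnb : ∀ k, ¬ bad τ k := by
      rintro k ⟨m, -, τ', -, hcomp, hne, hsome⟩
      refine hne (huniq τ' hcomp ?_)
      obtain ⟨n, hn⟩ := Option.isSome_iff_exists.1 hsome
      have := Nat.Partrec.Code.evaln_sound hn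
      rw [hev] at this
      exact (Part.dom_iff_mem.2 ⟨n, this⟩ : ((f τ').map encode).Dom)
    have hmem : encode y ∈ c.eval (encode τ) := by
      rw [hev]; exact Part.mem_map _ hy
    obtain ⟨k, hk⟩ := Nat.Partrec.Code.evaln_complete.1 hmem
    have hdom : (Nat.rfindOpt (s τ)).Dom := by
      refine Nat.rfindOpt_dom.2 ⟨k, y, ?_⟩
      simp only [s, hnb, if_false]
      exact Option.bind_eq_some_iff.2 ⟨_, hk, by simp⟩
    obtain ⟨y', hy'⟩ := Part.dom_iff_mem.1 hdom
    obtain ⟨k', hk'⟩ := Nat.rfindOpt_spec hy'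
    simp only [s, hnb, if_false] at hk'
    obtain ⟨n, hn, hd⟩ := Option.bind_eq_some_iff.1 hk'
    have h2 := Nat.Partrec.Code.evaln_sound hn
    have h3 := Part.mem_unique h2 hmem
    subst h3
    simp only [encodek, Option.some.injEq] at hd
    exact hd ▸ hy'

theorem replicate_false_prefix_iff : ∀ (e e' : ℕ) (σ σ' : List Bool),
    (List.replicate e false ++ true :: σ) <+: (List.replicate e' false ++ true :: σ') →
      e = e' ∧ σ <+: σ'
  | 0, 0, σ, σ', h => by simpa using h
  | 0, e' + 1, σ, σ', h => by simp [List.replicate_succ] at h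
  | e + 1, 0, σ, σ', h => by simp [List.replicate_succ] at h
  | e + 1, e' + 1, σ, σ', h => by
      simp only [List.replicate_succ, List.cons_append, List.cons_prefix_cons, true_and] at h
      have := replicate_false_prefix_iff e e' σ σ' h
      exact ⟨by rw [this.1], this.2⟩

/-- Optimal prefix-free machines exist. -/
theorem exists_isOptimalPrefixFreeMachine :
    ∃ U : List Bool →. List Bool, IsOptimalPrefixFreeMachine U := by
  let idx : List Bool → ℕ := fun τ => τ.findIdx id
  let ev : List Bool →. List Bool := fun τ =>
    ((Denumerable.ofNat Nat.Partrec.Code (idx τ)).eval (encode (τ.drop (idx τ + 1)))).bind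
      fun n => ((decode n : Option (List Bool)) : Part (List Bool))
  let f : List Bool →. List Bool := fun τ =>
    bif decide (idx τ < τ.length) then ev τ else Part.none
  have hidx : Primrec idx := Primrec.list_findIdx Primrec.id Primrec.snd
  have hev : Partrec ev := by
    refine Partrec.bind (Nat.Partrec.Code.eval_part.comp
      ((Primrec.ofNat _).comp hidx).to_comp
      (Primrec.encode.comp (Primrec.list_drop.comp (Primrec.succ.comp hidx) Primrec.id)).to_comp) ?_
    exact (Computable.decode.comp Computable.snd).ofOption
  have hf : Partrec f :=
    Partrec.cond (PrimrecPred.decide (Primrec.nat_lt.comp hidx Primrec.list_length)).to_comp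
      hev Partrec.none
  have hidx' : ∀ e σ, idx (List.replicate e false ++ true :: σ) = e := by
    intro e σ
    induction e with
    | zero => simp [idx, List.findIdx_cons]
    | succ e ih => simpa [idx, List.replicate_succ, List.findIdx_cons] using ih
  have hval : ∀ e σ, f (List.replicate e false ++ true :: σ) =
      ((Denumerable.ofNat Nat.Partrec.Code e).eval (encode σ)).bind
        fun n => ((decode n : Option (List Bool)) : Part (List Bool)) := by
    intro e σ
    have hd : List.drop (e + 1) (List.replicate e false ++ true :: σ) = σ := by
      simp [List.drop_append]
    simp only [f, ev, hidx', hd]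
    simp
  have hform : ∀ τ, (f τ).Dom → ∃ e σ, τ = List.replicate e false ++ true :: σ := by
    intro τ h
    have hlt : idx τ < τ.length := by
      by_contra hh
      simp [f, hh] at h
    refine ⟨idx τ, τ.drop (idx τ + 1), ?_⟩
    have : ∀ τ : List Bool, idx τ < τ.length →
        τ = List.replicate (idx τ) false ++ true :: τ.drop (idx τ + 1) := by
      intro τ
      induction τ with
      | nil => intro h; simp at h
      | cons b τ ih =>
        cases b with
        | true => intro _; simp [idx, List.findIdx_cons]
        | false =>
          intro h
          have e1 : idx (false :: τ) = idx τ + 1 := by simp [idx, List.findIdx_cons]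
          rw [e1] at h ⊢
          have := ih (by simpa using h)
          simpa [List.replicate_succ] using this
    exact this τ hlt
  obtain ⟨U, hU, hUf⟩ := exists_prefixFree_restriction f hf
  refine ⟨U, hU, fun M hM => ?_⟩
  obtain ⟨c, hc⟩ := Nat.Partrec.Code.exists_code.1 hM.1
  have hMf : ∀ σ, f (List.replicate (encode c) false ++ true :: σ) = M σ := by
    intro σ
    rw [hval, Denumerable.ofNat_encode, hc]
    ext y
    simp
  refine ⟨encode c + 1, fun y => ?_⟩
  unfold machineComplexity
  by_cases hne : ∃ σ, y ∈ M σ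
  swap
  · have : {σ : List Bool | y ∈ M σ} = ∅ := by
      ext σ; simpa using fun h => hne ⟨σ, h⟩
    rw [this]; simp
  have hle : ∀ σ, y ∈ M σ → (⨅ τ ∈ {τ : List Bool | y ∈ U τ}, (τ.length : ℕ∞)) ≤
      σ.length + ((encode c + 1 : ℕ) : ℕ∞) := by
    intro σ hσ
    have hy : y ∈ U (List.replicate (encode c) false ++ true :: σ) := by
      refine hUf _ y (by rw [hMf]; exact hσ) ?_
      intro τ' hcomp hdom
      obtain ⟨e, σ', rfl⟩ := hform τ' hdom
      have hd : (M σ).Dom := Part.dom_iff_mem.2 ⟨y, hσ⟩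
      rcases hcomp with h | h
      · obtain ⟨rfl, h2⟩ := replicate_false_prefix_iff _ _ _ _ h
        rw [hMf] at hdom
        rw [hM.2 _ _ hd hdom h2]
      · obtain ⟨rfl, h2⟩ := replicate_false_prefix_iff _ _ _ _ h
        rw [hMf] at hdom
        rw [hM.2 _ _ hdom hd h2]
    refine (iInf₂_le (f := fun (τ : List Bool) (_ : τ ∈ {τ : List Bool | y ∈ U τ}) =>
      (τ.length : ℕ∞)) _ hy).trans (le_of_eq ?_)
    rw [← Nat.cast_add]
    congr 1
    simp; omega
  obtain ⟨σ₀, hσ₀, hmin⟩ : ∃ σ, y ∈ M σ ∧ ∀ τ, y ∈ M τ → σ.length ≤ τ.length := by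
    obtain ⟨σ, h1, h2⟩ := (measure (List.length (α := Bool))).wf.has_min
      {σ | y ∈ M σ} hne
    exact ⟨σ, h1, fun τ hτ => not_lt.1 (h2 τ hτ)⟩
  refine (hle σ₀ hσ₀).trans ?_
  gcongr
  exact le_iInf₂ fun τ hτ => by exact_mod_cast hmin τ hτ

/-- An effective injective encoding of tuples of natural numbers by binary strings:
`(n₀, …, n_k)` becomes `1^{n₀} 0 1^{n₁} 0 … 1^{n_k} 0`. -/
def tupleCode (l : List ℕ) : List Bool :=
  l.flatMap fun n => List.replicate n true ++ [false]

/-- A function `α : ℕ → ℕ` is `K`-trivial if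
`K (α 0, …, α (n - 1)) ≤ K (0 ^ n) + b` for some `b` and all `n`.  The choice of the optimal
prefix-free machine defining `K` is immaterial; here the condition is demanded for each choice
(and such machines exist by `exists_isOptimalPrefixFreeMachine`). -/
def IsKTrivialFunction (α : ℕ → ℕ) : Prop :=
  ∀ U : List Bool →. List Bool, IsOptimalPrefixFreeMachine U →
    ∃ b : ℕ, ∀ n : ℕ,
      machineComplexity U (tupleCode ((List.range n).map α)) ≤
        machineComplexity U (List.replicate n false) + b

section MetricSpaces

variable {M : Type*} [MetricSpace M]

/-- `q` is a computable structure on the metric space `M`: a dense sequence without repetitions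
such that `dist (q i) (q k)` is a computable real uniformly in `i, k`, i.e. a computable function
yields, for all `i, k, n`, a dyadic rational `f (i, k, n) / 2 ^ n` within `2 ^ (-n)` of it
(numerators in `ℕ` suffice as distances are nonnegative).  The `q i` are the special points. -/
structure IsComputableStructure (q : ℕ → M) : Prop where
  injective : Function.Injective q
  denseRange : DenseRange q
  computable_dist : ∃ f : ℕ × ℕ × ℕ → ℕ, Computable f ∧
    ∀ i k n : ℕ, |dist (q i) (q k) - (f (i, k, n) : ℝ) / 2 ^ n| ≤ 1 / 2 ^ n

/-- `α` is (the sequence of indices of) a Cauchy name for `x`: `d(p_s, p_t) ≤ 2 ^ (-s)` for all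
`s ≤ t`, where `p_s = q (α s)`, and `p_s` converges to `x`. -/
def IsCauchyName (q : ℕ → M) (α : ℕ → ℕ) (x : M) : Prop :=
  (∀ s t : ℕ, s ≤ t → dist (q (α s)) (q (α t)) ≤ 1 / 2 ^ s) ∧
    Filter.Tendsto (fun s => q (α s)) Filter.atTop (nhds x)

/-- A point is computable if it has a computable Cauchy name. -/
def IsComputablePoint (q : ℕ → M) (x : M) : Prop :=
  ∃ α : ℕ → ℕ, Computable α ∧ IsCauchyName q α x

/-- A point is `K`-trivial if it has a Cauchy name that is `K`-trivial as a function. -/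
def IsKTrivialPoint (q : ℕ → M) (x : M) : Prop :=
  ∃ α : ℕ → ℕ, IsKTrivialFunction α ∧ IsCauchyName q α x

end MetricSpaces

/-! There is a non-computable `K`-trivial set of naturals, and Cantor space embeds effectively into
every perfect computable metric space. The required point is the image of that set.

The set `A` comes from a cost function construction. A change of the approximation at `x` costs the
total weight of the descriptions seen so far whose outputs are longer than `x`. If the total cost of
all changes is bounded, the Kraft–Chaitin theorem (`exists_prefixFreeMachine_of_requests`) yields a
machine that describes `A 0, …, A (n - 1)` with only a constant more bits than a given description
of `0 ^ n`; this is `machineComplexity_initialSegment_le`. Diagonalization stays within this bound: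
the `e`-th requirement acts at most once, at cost at most `2 ^ (-e)`. It can always find a cheap
witness, because by Kraft's inequality the cost tends to `0` uniformly in the stage.

For the embedding, perfectness lets a computable search split every ball around a special point into
two well separated smaller ones (`exists_isSplitting`). The centres along the branch `A` form a
Cauchy name. Its first `n` entries are a computable function of the first `n` bits of `A`, so the
name is `K`-trivial. Conversely, a computable name of the limit would decide at each split which way
the branch goes, and so compute `A` (`computable_of_isComputablePoint`). -/

/-! ### Complexity bounds and Kraft's inequality -/

theorem machineComplexity_le_length {M : List Bool →. List Bool} {σ y : List Bool} (h : y ∈ M σ) :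
    machineComplexity M y ≤ σ.length :=
  iInf₂_le (f := fun (τ : List Bool) (_ : τ ∈ {τ : List Bool | y ∈ M τ}) => (τ.length : ℕ∞)) σ h

theorem le_machineComplexity_add {M : List Bool →. List Bool} {y : List Bool} {a : ℕ∞} {b : ℕ}
    (h : ∀ σ, y ∈ M σ → a ≤ σ.length + b) : a ≤ machineComplexity M y + b := by
  by_cases hne : ∃ σ, y ∈ M σ
  · obtain ⟨σ₀, hσ₀, hmin⟩ : ∃ σ, y ∈ M σ ∧ ∀ τ, y ∈ M τ → σ.length ≤ τ.length := by
      obtain ⟨σ, h1, h2⟩ := (measure (List.length (α := Bool))).wf.has_min {σ | y ∈ M σ} hne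
      exact ⟨σ, h1, fun τ hτ => not_lt.1 (h2 τ hτ)⟩
    refine (h σ₀ hσ₀).trans ?_
    gcongr
    exact le_iInf₂ fun τ hτ => by exact_mod_cast hmin τ hτ
  · have : machineComplexity M y = ⊤ := by
      simp only [machineComplexity, iInf_eq_top]
      exact fun σ hσ => (hne ⟨σ, hσ⟩).elim
    simp [this]

theorem IsPrefixFreeMachine.map {M : List Bool →. List Bool} (hM : IsPrefixFreeMachine M)
    {f : List Bool → List Bool} (hf : Computable f) :
    IsPrefixFreeMachine fun σ => (M σ).map f :=
  ⟨hM.1.map (hf.comp Computable.snd).to₂, fun σ τ hσ hτ => hM.2 σ τ hσ hτ⟩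

theorem IsOptimalPrefixFreeMachine.exists_machineComplexity_comp_le {U : List Bool →. List Bool}
    (hU : IsOptimalPrefixFreeMachine U) {f : List Bool → List Bool} (hf : Computable f) :
    ∃ d : ℕ, ∀ y, machineComplexity U (f y) ≤ machineComplexity U y + d := by
  obtain ⟨d, hd⟩ := hU.2 _ (hU.1.map hf)
  refine ⟨d, fun y => (hd (f y)).trans ?_⟩
  gcongr
  exact le_iInf₂ fun σ hσ => machineComplexity_le_length (Part.mem_map f hσ)

theorem uniquelyDecodable_of_prefixFree {S : Set (List Bool)}
    (h : ∀ σ ∈ S, ∀ τ ∈ S, σ <+: τ → σ = τ) (hnil : [] ∉ S) :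
    InformationTheory.UniquelyDecodable S := by
  intro L₁
  induction L₁ with
  | nil =>
    rintro (_ | ⟨w, L₂⟩) h₁ h₂ hfl
    · rfl
    · have : w = [] := (List.append_eq_nil_iff.1 (List.flatten_cons ▸ hfl.symm)).1
      exact absurd (h₂ w (by simp)) (this ▸ hnil)
  | cons v L₁ ih =>
    rintro (_ | ⟨w, L₂⟩) h₁ h₂ hfl
    · have : v = [] := (List.append_eq_nil_iff.1 (List.flatten_cons ▸ hfl)).1
      exact absurd (h₁ v (by simp)) (this ▸ hnil)
    · simp only [List.flatten_cons] at hfl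
      have hv : v <+: w ++ L₂.flatten := hfl ▸ List.prefix_append _ _
      have hw : w <+: w ++ L₂.flatten := List.prefix_append _ _
      have hvw : v = w := by
        rcases List.prefix_or_prefix_of_prefix hv hw with h' | h'
        · exact h _ (h₁ v (by simp)) _ (h₂ w (by simp)) h'
        · exact (h _ (h₂ w (by simp)) _ (h₁ v (by simp)) h').symm
      subst hvw
      rw [ih L₂ (fun w hw => h₁ w (by simp [hw])) (fun w hw => h₂ w (by simp [hw]))
        (List.append_cancel_left hfl)]

/-- Prefix-free codes without the empty word are uniquely decodable, so Kraft–McMillan applies. A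
prefix-free set containing the empty word is a singleton. -/
theorem kraft_inequality_of_prefixFree {S : Finset (List Bool)}
    (h : ∀ σ ∈ S, ∀ τ ∈ S, σ <+: τ → σ = τ) : ∑ σ ∈ S, (1 / 2 : ℝ) ^ σ.length ≤ 1 := by
  by_cases hnil : [] ∈ S
  · have : S = {[]} := Finset.eq_singleton_iff_unique_mem.2
      ⟨hnil, fun τ hτ => (h _ hnil τ hτ List.nil_prefix).symm⟩
    simp [this]
  · simpa using InformationTheory.kraft_mcmillan_inequality
      (uniquelyDecodable_of_prefixFree (S := (S : Set (List Bool)))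
        (fun σ hσ τ hτ => h σ hσ τ hτ) hnil)

theorem Primrec.nat_pow : Primrec₂ ((· ^ ·) : ℕ → ℕ → ℕ) :=
  Primrec₂.unpaired'.1 Nat.Primrec.pow

/-! ### The Kraft–Chaitin theorem -/

/-- The weight `2 ^ (-r)` of an optional request of length `r`. -/
noncomputable def requestWeight {α : Type*} (o : Option (ℕ × α)) : ℝ :=
  o.elim 0 fun p => (1 / 2) ^ p.1

theorem requestWeight_nonneg {α : Type*} (o : Option (ℕ × α)) : 0 ≤ requestWeight o := by
  cases o <;> simp [requestWeight]

/-- The least `v` with `a / 2 ^ l ≤ v / 2 ^ r`, where `p = (a, l)`. -/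
def ceilDyadic (p : ℕ × ℕ) (r : ℕ) : ℕ := (p.1 * 2 ^ r + (2 ^ p.2 - 1)) / 2 ^ p.2

/-- The right end of the first dyadic interval of length `2 ^ (-r)` to the right of `p`. -/
def allocateDyadic (p : ℕ × ℕ) (r : ℕ) : ℕ × ℕ := ((ceilDyadic p r + 1) * 2 ^ p.2, p.2 + r)

/-- The left end of the part of the unit interval that is still free after the first `m` requests
have been allocated. -/
def freePosition {α : Type*} (R : ℕ → Option (ℕ × α)) (m : ℕ) : ℕ × ℕ :=
  Nat.rec (0, 0) (fun m p => (R m).elim p fun q => allocateDyadic p q.1) m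

/-- The real number denoted by a dyadic pair. -/
noncomputable def dyadicReal (p : ℕ × ℕ) : ℝ := p.1 / 2 ^ p.2

/-- The natural number with binary expansion `σ`, most significant digit first. -/
def bitsValue (σ : List Bool) : ℕ := σ.foldl (fun a b => 2 * a + b.toNat) 0

theorem primrec_ceilDyadic : Primrec₂ ceilDyadic := by
  have hp : Primrec fun x : (ℕ × ℕ) × ℕ => 2 ^ x.1.2 :=
    Primrec.nat_pow.comp (Primrec.const 2) (Primrec.snd.comp Primrec.fst)
  exact Primrec.nat_div.comp (Primrec.nat_add.comp
    (Primrec.nat_mul.comp (Primrec.fst.comp Primrec.fst)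
      (Primrec.nat_pow.comp (Primrec.const 2) Primrec.snd))
    (Primrec.nat_sub.comp hp (Primrec.const 1))) hp

theorem primrec_allocateDyadic : Primrec₂ allocateDyadic :=
  (Primrec.nat_mul.comp (Primrec.succ.comp primrec_ceilDyadic)
    (Primrec.nat_pow.comp (Primrec.const 2) (Primrec.snd.comp Primrec.fst))).pair
    (Primrec.nat_add.comp (Primrec.snd.comp Primrec.fst) Primrec.snd)

theorem computable_freePosition {α : Type*} [Primcodable α] {R : ℕ → Option (ℕ × α)}
    (hR : Computable R) : Computable (freePosition R) := by
  refine (Computable.nat_rec (f := id) (g := fun _ : ℕ => ((0, 0) : ℕ × ℕ))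
    (h := fun _ x => (R x.1).elim x.2 fun q => allocateDyadic x.2 q.1)
    Computable.id (Computable.const _) ?_)
  refine (Computable.option_casesOn (o := fun x : ℕ × ℕ × ℕ × ℕ => R x.2.1)
    (f := fun x => x.2.2) (g := fun x q => allocateDyadic x.2.2 q.1)
    (hR.comp (Computable.fst.comp Computable.snd)) (Computable.snd.comp Computable.snd)
    (primrec_allocateDyadic.to_comp.comp (Computable.snd.comp (Computable.snd.comp Computable.fst))
      (Computable.fst.comp Computable.snd))).of_eq ?_
  intro x
  dsimp only
  cases R x.2.1 <;> rfl

theorem primrec_bitsValue : Primrec bitsValue :=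
  Primrec.list_foldl Primrec.id (Primrec.const 0)
    (Primrec.nat_add.comp
      (Primrec.nat_mul.comp (Primrec.const 2) (Primrec.fst.comp Primrec.snd))
      ((Primrec.dom_bool Bool.toNat).comp (Primrec.snd.comp Primrec.snd))).to₂

theorem dyadicReal_le_ceilDyadic (p : ℕ × ℕ) (r : ℕ) :
    dyadicReal p ≤ (ceilDyadic p r : ℝ) / 2 ^ r := by
  have h : p.1 * 2 ^ r ≤ ceilDyadic p r * 2 ^ p.2 := by
    have h1 := Nat.lt_div_mul_add (a := p.1 * 2 ^ r + (2 ^ p.2 - 1)) (b := 2 ^ p.2) (by positivity)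
    have h2 : 0 < 2 ^ p.2 := by positivity
    unfold ceilDyadic
    omega
  rw [dyadicReal, div_le_div_iff₀ (by positivity) (by positivity)]
  exact_mod_cast h

theorem dyadicReal_allocateDyadic (p : ℕ × ℕ) (r : ℕ) :
    dyadicReal (allocateDyadic p r) = ((ceilDyadic p r : ℝ) + 1) / 2 ^ r := by
  simp only [dyadicReal, allocateDyadic, Nat.cast_mul, Nat.cast_add, Nat.cast_one, Nat.cast_pow,
    Nat.cast_ofNat, pow_add]
  field_simp

/-- Rounding up to a multiple of `2 ^ (-r)` skips less than one interval length, and the allocated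
interval takes another. This factor `2` is why the total weight of requests is required to be at
most `1 / 2`. -/
theorem dyadicReal_allocateDyadic_le (p : ℕ × ℕ) (r : ℕ) :
    dyadicReal (allocateDyadic p r) ≤ dyadicReal p + 2 * (1 / 2) ^ r := by
  have h : ceilDyadic p r * 2 ^ p.2 ≤ p.1 * 2 ^ r + 2 ^ p.2 := by
    have h1 := Nat.div_mul_le_self (p.1 * 2 ^ r + (2 ^ p.2 - 1)) (2 ^ p.2)
    have h2 : 0 < 2 ^ p.2 := by positivity
    unfold ceilDyadic
    omega
  have h' : (ceilDyadic p r : ℝ) * 2 ^ p.2 ≤ p.1 * 2 ^ r + 2 ^ p.2 := by exact_mod_cast h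
  rw [dyadicReal_allocateDyadic, dyadicReal, div_pow, one_pow, ← sub_nonneg]
  have : (p.1 : ℝ) / 2 ^ p.2 + 2 * (1 / 2 ^ r) - ((ceilDyadic p r : ℝ) + 1) / 2 ^ r =
      (p.1 * 2 ^ r + 2 ^ p.2 - ceilDyadic p r * 2 ^ p.2) / (2 ^ p.2 * 2 ^ r) := by
    field_simp; ring
  rw [this]
  apply div_nonneg <;> [linarith; positivity]

section freePosition

variable {α : Type*} {R : ℕ → Option (ℕ × α)}

theorem freePosition_succ_of_some {m : ℕ} {q : ℕ × α} (h : R m = some q) :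
    freePosition R (m + 1) = allocateDyadic (freePosition R m) q.1 := by
  change (R m).elim _ _ = _
  rw [h]; rfl

theorem dyadicReal_freePosition_mono : Monotone fun m => dyadicReal (freePosition R m) := by
  refine monotone_nat_of_le_succ fun m => ?_
  cases h : R m with
  | none =>
    change _ ≤ dyadicReal ((R m).elim _ _)
    rw [h]; rfl
  | some q =>
    rw [freePosition_succ_of_some h, dyadicReal_allocateDyadic]
    refine (dyadicReal_le_ceilDyadic _ q.1).trans ?_
    gcongr
    linarith

theorem dyadicReal_freePosition_le (m : ℕ) :
    dyadicReal (freePosition R m) ≤ 2 * ∑ j ∈ Finset.range m, requestWeight (R j) := by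
  induction m with
  | zero => simp [freePosition, dyadicReal]
  | succ m ih =>
    rw [Finset.sum_range_succ]
    cases h : R m with
    | none =>
      change dyadicReal ((R m).elim _ _) ≤ _
      rw [h]
      simpa [requestWeight, freePosition] using ih
    | some q =>
      rw [freePosition_succ_of_some h]
      have := dyadicReal_allocateDyadic_le (freePosition R m) q.1
      simp only [requestWeight, Option.elim] at ih ⊢
      linarith

end freePosition

theorem foldl_bits_append (σ : List Bool) (a : ℕ) :
    σ.foldl (fun a b => 2 * a + b.toNat) a = a * 2 ^ σ.length + bitsValue σ := by
  induction σ generalizing a with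
  | nil => simp [bitsValue]
  | cons b σ ih =>
    have h : bitsValue (b :: σ) = _ := ih (2 * 0 + b.toNat)
    rw [h, List.foldl_cons, ih, List.length_cons]
    ring

theorem bitsValue_lt (σ : List Bool) : bitsValue σ < 2 ^ σ.length := by
  induction σ with
  | nil => simp [bitsValue]
  | cons b σ ih =>
    have h := foldl_bits_append σ (2 * 0 + b.toNat)
    change bitsValue (b :: σ) = _ at h
    rw [h, List.length_cons, pow_succ]
    have hb : b.toNat ≤ 1 := Bool.toNat_le b
    nlinarith

theorem bitsValue_append (σ τ : List Bool) :
    bitsValue (σ ++ τ) = bitsValue σ * 2 ^ τ.length + bitsValue τ := by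
  rw [← foldl_bits_append]
  simp [bitsValue]

theorem exists_bitsValue_eq (r v : ℕ) (h : v < 2 ^ r) :
    ∃ σ : List Bool, σ.length = r ∧ bitsValue σ = v := by
  induction r generalizing v with
  | zero => exact ⟨[], rfl, by simp at h; simp [bitsValue, h]⟩
  | succ r ih =>
    obtain ⟨σ, hσ, hv⟩ := ih (v / 2) (by rw [pow_succ] at h; omega)
    refine ⟨σ ++ [decide (v % 2 = 1)], by simp [hσ], ?_⟩
    rw [bitsValue_append, hv]
    rcases Nat.mod_two_eq_zero_or_one v with h' | h' <;> simp [h', bitsValue] <;> omega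

/-- The string asked for by the request `q`, provided that `τ` is the codeword allocated to `q` when
the free part of the unit interval starts at `p`. -/
def requestAnswer (τ : List Bool) (p : ℕ × ℕ) (q : ℕ × List Bool) : Option (List Bool) :=
  if q.1 = τ.length ∧ ceilDyadic p q.1 = bitsValue τ then some q.2 else none

theorem primrec_requestAnswer :
    Primrec fun x : List Bool × (ℕ × ℕ) × ℕ × List Bool => requestAnswer x.1 x.2.1 x.2.2 := by
  have hq : Primrec fun x : List Bool × (ℕ × ℕ) × ℕ × List Bool => x.2.2 :=
    Primrec.snd.comp Primrec.snd
  have hr : Primrec fun x : List Bool × (ℕ × ℕ) × ℕ × List Bool => x.2.2.1 := Primrec.fst.comp hq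
  exact Primrec.ite (PrimrecPred.and
    (Primrec.eq.comp hr (Primrec.list_length.comp Primrec.fst))
    (Primrec.eq.comp (primrec_ceilDyadic.comp (Primrec.fst.comp Primrec.snd) hr)
      (primrec_bitsValue.comp Primrec.fst)))
    (Primrec.option_some.comp (Primrec.snd.comp hq)) (Primrec.const none)

theorem computable_requestAnswer_freePosition {R : ℕ → Option (ℕ × List Bool)} (hR : Computable R) :
    Computable fun x : (List Bool × ℕ) × ℕ × List Bool =>
      requestAnswer x.1.1 (freePosition R x.1.2) x.2 := by
  have hF : Computable fun x : (List Bool × ℕ) × ℕ × List Bool =>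
      (x.1.1, freePosition R x.1.2, x.2) :=
    (Computable.fst.comp Computable.fst).pair
      (((computable_freePosition hR).comp (Computable.snd.comp Computable.fst)).pair
        Computable.snd)
  have h := primrec_requestAnswer.to_comp
  generalize requestAnswer = g at h ⊢
  exact h.comp hF

/-- The Kraft–Chaitin theorem. -/
theorem exists_prefixFreeMachine_of_requests {R : ℕ → Option (ℕ × List Bool)} (hR : Computable R)
    (hw : ∀ N, ∑ m ∈ Finset.range N, requestWeight (R m) ≤ 1 / 2) :
    ∃ N : List Bool →. List Bool, IsPrefixFreeMachine N ∧
      ∀ m r y, R m = some (r, y) → machineComplexity N y ≤ r := by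
  let s : List Bool → ℕ → Option (List Bool) := fun τ m => (R m).bind (requestAnswer τ (freePosition R m))
  have hs : Computable₂ s := by
    have h : Computable₂ fun (x : List Bool × ℕ) (q : ℕ × List Bool) =>
        requestAnswer x.1 (freePosition R x.2) q :=
      computable_requestAnswer_freePosition hR
    exact Computable.option_bind (hR.comp Computable.snd) h
  have hmem : ∀ τ m y, y ∈ s τ m ↔
      R m = some (τ.length, y) ∧ ceilDyadic (freePosition R m) τ.length = bitsValue τ := by
    intro τ m y
    simp only [s, requestAnswer, Option.mem_def, Option.bind_eq_some_iff, Prod.exists]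
    constructor
    · rintro ⟨r, y', h1, h2⟩
      split_ifs at h2 with h3
      obtain ⟨rfl, h4⟩ := h3
      simp only [Option.some.injEq] at h2
      exact ⟨h2 ▸ h1, h4⟩
    · rintro ⟨h1, h2⟩
      exact ⟨_, _, h1, by simp [h2]⟩
  have hint : ∀ τ m y, y ∈ s τ m →
      dyadicReal (freePosition R m) ≤ (bitsValue τ : ℝ) / 2 ^ τ.length ∧
      dyadicReal (freePosition R (m + 1)) = ((bitsValue τ : ℝ) + 1) / 2 ^ τ.length := by
    intro τ m y h
    obtain ⟨h1, h2⟩ := (hmem _ _ _).1 h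
    rw [freePosition_succ_of_some h1, dyadicReal_allocateDyadic]
    simp only [h2, and_true]
    exact h2 ▸ dyadicReal_le_ceilDyadic _ _
  -- The interval of an extension lies inside that of its prefix, whereas distinct requests get
  -- disjoint intervals because the free position only moves to the right.
  have key : ∀ σ τ m m' y y', y ∈ s σ m → y' ∈ s τ m' → σ <+: τ → m = m' := by
    rintro σ _ m m' y y' h h' ⟨ρ, rfl⟩
    have hρ := bitsValue_lt ρ
    obtain ⟨a1, a2⟩ := hint _ _ _ h
    obtain ⟨b1, b2⟩ := hint _ _ _ h'
    have hρ' : (bitsValue ρ : ℝ) + 1 ≤ 2 ^ ρ.length := by exact_mod_cast hρ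
    rw [bitsValue_append, List.length_append, pow_add] at b1 b2
    push_cast at b1 b2
    have e1 : (bitsValue σ : ℝ) / 2 ^ σ.length <
        (bitsValue σ * 2 ^ ρ.length + bitsValue ρ + 1) / (2 ^ σ.length * 2 ^ ρ.length) := by
      rw [div_lt_div_iff₀ (by positivity) (by positivity)]
      have : (0 : ℝ) < 2 ^ σ.length * (bitsValue ρ + 1) := by positivity
      nlinarith
    have e2 : (bitsValue σ * 2 ^ ρ.length + bitsValue ρ : ℝ) / (2 ^ σ.length * 2 ^ ρ.length) <
        (bitsValue σ + 1) / 2 ^ σ.length := by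
      rw [div_lt_div_iff₀ (by positivity) (by positivity)]
      have : (0 : ℝ) < 2 ^ σ.length * (2 ^ ρ.length - bitsValue ρ) := by
        apply mul_pos (by positivity); linarith
      nlinarith
    rcases lt_trichotomy m m' with hlt | heq | hlt
    · have := dyadicReal_freePosition_mono (R := R) (Nat.succ_le_of_lt hlt)
      simp only [Nat.succ_eq_add_one] at this
      linarith
    · exact heq
    · have := dyadicReal_freePosition_mono (R := R) (Nat.succ_le_of_lt hlt)
      simp only [Nat.succ_eq_add_one] at this
      linarith
  refine ⟨fun τ => Nat.rfindOpt (s τ), ⟨Partrec.rfindOpt hs, ?_⟩, ?_⟩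
  · intro σ τ h h' hp
    obtain ⟨m, y, hy⟩ := Nat.rfindOpt_dom.1 h
    obtain ⟨m', y', hy'⟩ := Nat.rfindOpt_dom.1 h'
    obtain rfl := key σ τ m m' y y' hy hy' hp
    have h1 := ((hmem _ _ _).1 hy).1.symm.trans ((hmem _ _ _).1 hy').1
    simp only [Option.some.injEq, Prod.mk.injEq] at h1
    exact hp.eq_of_length h1.1
  · intro m r y h
    have hlt : ceilDyadic (freePosition R m) r < 2 ^ r := by
      have h1 := dyadicReal_freePosition_le (R := R) (m + 1)
      rw [freePosition_succ_of_some h, dyadicReal_allocateDyadic] at h1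
      have h2 := h1.trans (mul_le_mul_of_nonneg_left (hw (m + 1)) zero_le_two)
      rw [div_le_iff₀ (by positivity)] at h2
      have : (ceilDyadic (freePosition R m) r : ℝ) + 1 ≤ 2 ^ r := by simpa using h2
      exact_mod_cast this
    obtain ⟨σ, rfl, hv⟩ := exists_bitsValue_eq r _ hlt
    have hy : y ∈ s σ m := (hmem _ _ _).2 ⟨h, hv.symm⟩
    refine machineComplexity_le_length ?_
    obtain ⟨y', hy'⟩ := Part.dom_iff_mem.1 (Nat.rfindOpt_dom.2 ⟨m, y, hy⟩)
    obtain ⟨m', hm'⟩ := Nat.rfindOpt_spec hy'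
    -- A codeword serves only one request, so the unbounded search returns the intended string.
    obtain rfl := key σ σ m m' y y' hy hm' (List.prefix_refl _)
    rwa [Option.mem_unique hy hm']

/-! ### Enumerating the descriptions of a prefix-free machine -/

theorem Primrec.sum_range {α : Type*} [Primcodable α] {f : α → ℕ → ℕ} (hf : Primrec₂ f) :
    Primrec₂ fun a m => ∑ t ∈ Finset.range m, f a t := by
  refine (Primrec.nat_rec (f := fun _ : α => 0) (g := fun a p => p.2 + f a p.1)
    (Primrec.const 0) ?_).of_eq fun a m => ?_
  · exact Primrec.nat_add.comp (Primrec.snd.comp Primrec.snd)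
      (hf.comp Primrec.fst (Primrec.fst.comp Primrec.snd))
  · induction m with
    | zero => rfl
    | succ m ih => rw [Finset.sum_range_succ, ← ih]

/-- If the computation `c` on the string with code `t.unpair.1` takes exactly `t.unpair.2 + 1` steps,
the lengths of that string and of the output. -/
def descriptionLengths (c : Nat.Partrec.Code) (t : ℕ) : Option (ℕ × ℕ) :=
  if (c.evaln t.unpair.2 t.unpair.1).isSome then none else
    (decode t.unpair.1 : Option (List Bool)).bind fun σ =>
      if encode σ = t.unpair.1 then
        ((c.evaln (t.unpair.2 + 1) t.unpair.1).bind (decode : ℕ → Option (List Bool))).map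
          fun y => (σ.length, y.length)
      else none

theorem primrec_descriptionLengths (c : Nat.Partrec.Code) : Primrec (descriptionLengths c) := by
  have h1 : Primrec fun t : ℕ => t.unpair.1 := Primrec.fst.comp Primrec.unpair
  have h2 : Primrec fun t : ℕ => t.unpair.2 := Primrec.snd.comp Primrec.unpair
  have hev : ∀ {g : ℕ → ℕ}, Primrec g → Primrec fun t => c.evaln (g t) t.unpair.1 := fun hg =>
    Nat.Partrec.Code.primrec_evaln.comp ((hg.pair (Primrec.const c)).pair h1)
  refine Primrec.ite (Primrec.eq.comp (Primrec.option_isSome.comp (hev h2)) (Primrec.const true))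
    (Primrec.const none) (Primrec.option_bind (Primrec.decode.comp h1) ?_)
  refine Primrec.ite (Primrec.eq.comp (Primrec.encode.comp Primrec.snd) (h1.comp Primrec.fst)) ?_
    (Primrec.const none)
  refine Primrec.option_map (Primrec.option_bind ((hev (Primrec.succ.comp h2)).comp Primrec.fst)
    (Primrec.decode.comp Primrec.snd).to₂) ?_
  exact (Primrec.list_length.comp (Primrec.snd.comp Primrec.fst)).pair
    (Primrec.list_length.comp Primrec.snd)

theorem descriptionLengths_eq_some {c : Nat.Partrec.Code} {t r n : ℕ}
    (h : descriptionLengths c t = some (r, n)) :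
    ∃ σ y : List Bool, t.unpair.1 = encode σ ∧ σ.length = r ∧ y.length = n ∧
      c.evaln t.unpair.2 (encode σ) = none ∧
      ∃ e ∈ c.evaln (t.unpair.2 + 1) (encode σ), decode e = some y := by
  unfold descriptionLengths at h
  split_ifs at h with h1
  obtain ⟨σ, hσ, h2⟩ := Option.bind_eq_some_iff.1 h
  split_ifs at h2 with h3
  obtain ⟨y, hy, h4⟩ := Option.map_eq_some_iff.1 h2
  obtain ⟨e, he, h5⟩ := Option.bind_eq_some_iff.1 hy
  simp only [Prod.mk.injEq] at h4
  rw [← h3] at h1 he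
  exact ⟨σ, y, h3.symm, h4.1, h4.2, by simpa using h1, e, he, h5⟩

/-- Indices code pairs of a string and a halting stage, so each halting string is listed exactly
once and the weight bound is Kraft's inequality. The bound `r ≤ t` later makes `2 ^ (m - r)` a
genuine scaling of `2 ^ (-r)` for `t < m`, despite truncated subtraction. -/
theorem IsPrefixFreeMachine.exists_primrec_enumeration {U : List Bool →. List Bool}
    (hU : IsPrefixFreeMachine U) :
    ∃ D : ℕ → Option (ℕ × ℕ), Primrec D ∧ (∀ t r n, D t = some (r, n) → r ≤ t) ∧
      (∀ N, ∑ t ∈ Finset.range N, requestWeight (D t) ≤ 1) ∧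
      ∀ σ y, y ∈ U σ → ∃ t, D t = some (σ.length, y.length) := by
  classical
  obtain ⟨c, hc⟩ := Nat.Partrec.Code.exists_code.1 hU.1
  have hev : ∀ τ, c.eval (encode τ) = (U τ).map encode := by
    intro τ; rw [hc]; simp
  refine ⟨descriptionLengths c, primrec_descriptionLengths c, ?_, ?_, ?_⟩
  · intro t r n h
    obtain ⟨σ, y, h1, rfl, -⟩ := descriptionLengths_eq_some h
    exact (length_le_encode σ).trans (h1 ▸ Nat.unpair_left_le t)
  · intro N
    let S := (Finset.range N).filter fun t => (descriptionLengths c t).isSome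
    let d : ℕ → List Bool := fun t => ((decode t.unpair.1 : Option (List Bool))).getD []
    have hd : ∀ t ∈ S, t.unpair.1 = encode (d t) ∧
        requestWeight (descriptionLengths c t) = (1 / 2) ^ (d t).length ∧ (U (d t)).Dom ∧
        c.evaln t.unpair.2 (encode (d t)) = none ∧
        ∃ e, e ∈ c.evaln (t.unpair.2 + 1) (encode (d t)) := by
      intro t ht
      obtain ⟨⟨r, n⟩, hrn⟩ := Option.isSome_iff_exists.1 (Finset.mem_filter.1 ht).2
      obtain ⟨σ, y, h1, h2, h3, h4, e, h5, h6⟩ := descriptionLengths_eq_some hrn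
      have hσ : d t = σ := by simp [d, h1]
      rw [hσ, hrn]
      refine ⟨h1, by simp [requestWeight, h2], ?_, h4, e, h5⟩
      have h7 := Nat.Partrec.Code.evaln_sound h5
      rw [hev] at h7
      exact (Part.dom_iff_mem.2 ⟨e, h7⟩ : ((U σ).map encode).Dom)
    -- The string determines the index: the second component is the last stage before the
    -- computation halts.
    have hinj : Set.InjOn d S := by
      intro t ht t' ht' h
      obtain ⟨h1, -, -, h2, e, h3⟩ := hd t ht
      obtain ⟨h1', -, -, h2', e', h3'⟩ := hd t' ht'
      rw [← h] at h1' h2' h3'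
      have hle : ∀ {k k' e}, e ∈ c.evaln (k + 1) (encode (d t)) →
          c.evaln k' (encode (d t)) = none → k' ≤ k := by
        intro k k' e hk hk'
        by_contra hlt
        have := Nat.Partrec.Code.evaln_mono (Nat.succ_le_of_lt (not_le.1 hlt)) hk
        simp [hk'] at this
      have h4 : t.unpair.2 = t'.unpair.2 := le_antisymm (hle h3' h2) (hle h3 h2')
      rw [← Nat.pair_unpair t, ← Nat.pair_unpair t', h1, h1', h4]
    have hsum : ∑ t ∈ Finset.range N, requestWeight (descriptionLengths c t) =
        ∑ σ ∈ S.image d, (1 / 2 : ℝ) ^ σ.length := by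
      rw [Finset.sum_image hinj, Finset.sum_filter]
      refine Finset.sum_congr rfl fun t ht => ?_
      split_ifs with h
      · exact (hd t (Finset.mem_filter.2 ⟨ht, h⟩)).2.1
      · rw [Option.not_isSome_iff_eq_none] at h
        simp [h, requestWeight]
    rw [hsum]
    refine kraft_inequality_of_prefixFree fun σ hσ τ hτ => ?_
    obtain ⟨t, ht, rfl⟩ := Finset.mem_image.1 hσ
    obtain ⟨t', ht', rfl⟩ := Finset.mem_image.1 hτ
    exact hU.2 _ _ (hd t ht).2.2.1 (hd t' ht').2.2.1
  · intro σ y hy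
    have hmem : encode y ∈ c.eval (encode σ) := by
      rw [hev]; exact Part.mem_map _ hy
    have hex := Nat.Partrec.Code.evaln_complete.1 hmem
    obtain ⟨k, hk⟩ : ∃ k, Nat.find hex = k + 1 := by
      refine Nat.exists_eq_succ_of_ne_zero fun h0 => ?_
      have := Nat.Partrec.Code.evaln_bound (Nat.find_spec hex)
      omega
    have h1 := Nat.find_spec hex
    rw [hk, Option.mem_def] at h1
    have h2 : c.evaln k (encode σ) = none := by
      by_contra hne
      obtain ⟨e, he⟩ := Option.ne_none_iff_exists'.1 hne
      have h3 := Nat.Partrec.Code.evaln_mono (Nat.le_succ k) (Option.mem_def.2 he)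
      rw [Nat.succ_eq_add_one, Option.mem_def, h1, Option.some.injEq] at h3
      exact Nat.find_min hex (by omega : k < Nat.find hex) (h3 ▸ he)
    refine ⟨Nat.pair (encode σ) k, ?_⟩
    simp [descriptionLengths, h1, h2]

/-! ### Cheaply approximable sets are `K`-trivial -/

/-- The list `α 0, …, α (n - 1)`. -/
def initialSegment {β : Type*} (α : ℕ → β) (n : ℕ) : List β := (List.range n).map α

theorem initialSegment_eq_iff {β : Type*} {α α' : ℕ → β} {n : ℕ} :
    initialSegment α n = initialSegment α' n ↔ ∀ x < n, α x = α' x := by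
  simp [initialSegment]

/-- The requests that describe the current approximation `a (s + 1)`, cut off at the length given
by `D t`, as soon as `D t` appears and whenever that initial segment changes. -/
def approximationRequests (D : ℕ → Option (ℕ × ℕ)) (a : ℕ → ℕ → Bool) (i : ℕ) :
    Option (ℕ × List Bool) :=
  (D i.unpair.2).bind fun p =>
    if i.unpair.2 = i.unpair.1 ∨ (i.unpair.2 < i.unpair.1 ∧
      ¬ initialSegment (a i.unpair.1) p.2 = initialSegment (a (i.unpair.1 + 1)) p.2)
    then some (p.1 + 3, initialSegment (a (i.unpair.1 + 1)) p.2) else none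

theorem primrec_approximationRequests {D : ℕ → Option (ℕ × ℕ)} {a : ℕ → ℕ → Bool}
    (hD : Primrec D) (ha : Primrec₂ a) : Primrec (approximationRequests D a) := by
  have h1 : Primrec fun x : ℕ × ℕ × ℕ => x.1.unpair.1 :=
    Primrec.fst.comp (Primrec.unpair.comp Primrec.fst)
  have h2 : Primrec fun x : ℕ × ℕ × ℕ => x.1.unpair.2 :=
    Primrec.snd.comp (Primrec.unpair.comp Primrec.fst)
  have hs : ∀ {g : ℕ × ℕ × ℕ → ℕ}, Primrec g →
      Primrec fun x : ℕ × ℕ × ℕ => initialSegment (a (g x)) x.2.2 := fun hg =>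
    Primrec.list_map (Primrec.list_range.comp (Primrec.snd.comp Primrec.snd))
      (ha.comp (hg.comp Primrec.fst) Primrec.snd)
  refine Primrec.option_bind (hD.comp (Primrec.snd.comp Primrec.unpair)) ?_
  exact Primrec.ite (PrimrecPred.or (Primrec.eq.comp h2 h1) (PrimrecPred.and
    (Primrec.nat_lt.comp h2 h1)
    (PrimrecPred.not (Primrec.eq.comp (hs h1) (hs (Primrec.succ.comp h1))))))
    (Primrec.option_some.comp ((Primrec.nat_add.comp (Primrec.fst.comp Primrec.snd)
      (Primrec.const 3)).pair (hs (Primrec.succ.comp h1)))) (Primrec.const none)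

/-- The total weight of those requests among the first `s` ones in `D` that ask for an initial
segment containing a number from `X`. -/
noncomputable def changeWeight (D : ℕ → Option (ℕ × ℕ)) (X : Set ℕ) (s : ℕ) : ℝ :=
  open Classical in
  ∑ t ∈ Finset.range s, (D t).elim 0 fun p => if ∃ x ∈ X, x < p.2 then (1 / 2) ^ p.1 else 0

/-- Three extra bits scale all weights by `1 / 8`. The initial requests contribute at most `1`
before scaling and the updates at most `2`, and `3 / 8 ≤ 1 / 2`. -/
theorem sum_approximationRequests_le {D : ℕ → Option (ℕ × ℕ)} {a : ℕ → ℕ → Bool}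
    (hD : ∀ N, ∑ t ∈ Finset.range N, requestWeight (D t) ≤ 1)
    (ha : ∀ N, ∑ s ∈ Finset.range N, changeWeight D {x | a s x ≠ a (s + 1) x} s ≤ 2) (N : ℕ) :
    ∑ i ∈ Finset.range N, requestWeight (approximationRequests D a i) ≤ 1 / 2 := by
  classical
  let w : ℕ → ℕ → ℝ := fun s t =>
    requestWeight (approximationRequests D a (Nat.pair s t))
  have h1 : ∑ i ∈ Finset.range N, requestWeight (approximationRequests D a i) ≤
      ∑ s ∈ Finset.range N, ∑ t ∈ Finset.range N, w s t := by
    rw [← Finset.sum_product']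
    have hinj : Set.InjOn Nat.unpair (Finset.range N) := fun i _ j _ h => by
      rw [← Nat.pair_unpair i, ← Nat.pair_unpair j, h]
    have h2 : ∑ i ∈ Finset.range N, requestWeight (approximationRequests D a i) =
        ∑ q ∈ (Finset.range N).image Nat.unpair, w q.1 q.2 := by
      rw [Finset.sum_image hinj]
      simp [w]
    rw [h2]
    refine Finset.sum_le_sum_of_subset_of_nonneg ?_ fun _ _ _ => requestWeight_nonneg _
    intro q hq
    obtain ⟨i, hi, rfl⟩ := Finset.mem_image.1 hq
    have := Finset.mem_range.1 hi
    exact Finset.mem_product.2 ⟨Finset.mem_range.2 ((Nat.unpair_left_le i).trans_lt this),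
      Finset.mem_range.2 ((Nat.unpair_right_le i).trans_lt this)⟩
  -- At stage `s`, the index `t = s` gives the initial request, each `t < s` a request only after a
  -- change, and `t > s` nothing.
  have h3 : ∀ s ∈ Finset.range N, ∑ t ∈ Finset.range N, w s t ≤
      1 / 8 * (requestWeight (D s) + changeWeight D {x | a s x ≠ a (s + 1) x} s) := by
    intro s hs
    have hs' := Finset.mem_range.1 hs
    have hsub : Finset.range (s + 1) ⊆ Finset.range N := by
      intro t; simp only [Finset.mem_range]; omega
    rw [← Finset.sum_subset hsub, Finset.sum_range_succ, changeWeight, mul_add, Finset.mul_sum,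
      add_comm]
    · refine add_le_add ?_ (Finset.sum_le_sum fun t ht => ?_)
      · cases h : D s with
        | none => simp [w, approximationRequests, h, requestWeight]
        | some p =>
          refine le_of_eq ?_
          simp [w, approximationRequests, h, requestWeight, pow_add]
          ring
      · have ht' := Finset.mem_range.1 ht
        cases h : D t with
        | none => simp [w, approximationRequests, h, requestWeight]
        | some p =>
          refine le_of_eq ?_
          simp only [w, approximationRequests, h, Nat.unpair_pair, Option.bind_some, ht'.ne, ht',
            false_or, true_and, initialSegment_eq_iff, Option.elim, Set.mem_ofPred_eq]
          have : (¬ ∀ x < p.2, a s x = a (s + 1) x) ↔ ∃ x, a s x ≠ a (s + 1) x ∧ x < p.2 := by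
            push Not; exact exists_congr fun x => and_comm
          simp only [this]
          split_ifs
          · simp [requestWeight, pow_add]; ring
          · simp [requestWeight]
    · intro t _ ht
      have ht' : s < t := by simpa using ht
      cases h : D t with
      | none => simp [w, approximationRequests, h, requestWeight]
      | some p => simp [w, approximationRequests, h, requestWeight, ht'.ne', ht'.not_gt]
  refine h1.trans ((Finset.sum_le_sum h3).trans ?_)
  rw [← Finset.mul_sum, Finset.sum_add_distrib]
  linarith [hD N, ha N]

theorem IsOptimalPrefixFreeMachine.machineComplexity_initialSegment_le
    {U : List Bool →. List Bool} (hU : IsOptimalPrefixFreeMachine U) {D : ℕ → Option (ℕ × ℕ)}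
    (hD : Primrec D) (hDw : ∀ N, ∑ t ∈ Finset.range N, requestWeight (D t) ≤ 1)
    (hDU : ∀ σ y, y ∈ U σ → ∃ t, D t = some (σ.length, y.length))
    {a : ℕ → ℕ → Bool} (ha : Primrec₂ a)
    (haw : ∀ N, ∑ s ∈ Finset.range N, changeWeight D {x | a s x ≠ a (s + 1) x} s ≤ 2)
    {A : ℕ → Bool} (hA : ∀ x, ∀ᶠ s in Filter.atTop, a s x = A x) :
    ∃ b : ℕ, ∀ n, machineComplexity U (initialSegment A n) ≤
      machineComplexity U (List.replicate n false) + b := by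
  obtain ⟨N, hN, hR⟩ := exists_prefixFreeMachine_of_requests
    (primrec_approximationRequests hD ha).to_comp (sum_approximationRequests_le hDw haw)
  obtain ⟨d, hd⟩ := hU.2 N hN
  refine ⟨3 + d, fun n => le_machineComplexity_add fun σ hσ => ?_⟩
  obtain ⟨t, ht⟩ := hDU _ _ hσ
  rw [List.length_replicate] at ht
  -- At the least such stage the correct segment is requested: either `s = t`, or minimality says
  -- that the segment was still wrong one stage earlier, so it has just changed.
  have hex : ∃ s, t ≤ s ∧ ∀ x < n, a (s + 1) x = A x := by
    have h1 : ∀ᶠ s in Filter.atTop, ∀ x ∈ Finset.range n, a s x = A x :=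
      (Filter.eventually_all_finset _).2 fun x _ => hA x
    obtain ⟨S, hS⟩ := Filter.eventually_atTop.1 h1
    exact ⟨max t S, le_max_left _ _, fun x hx =>
      hS _ ((le_max_right _ _).trans (Nat.le_succ _)) x (Finset.mem_range.2 hx)⟩
  classical
  obtain ⟨h1, h2⟩ := Nat.find_spec hex
  set s := Nat.find hex with hs
  have hreq : approximationRequests D a (Nat.pair s t) =
      some (σ.length + 3, initialSegment A n) := by
    rw [← initialSegment_eq_iff] at h2
    simp only [approximationRequests, Nat.unpair_pair, ht, Option.bind_some, h2]
    refine if_pos ?_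
    rcases h1.eq_or_lt with h | h
    · exact Or.inl h
    · refine Or.inr ⟨h, fun heq => ?_⟩
      obtain ⟨s', hs'⟩ : ∃ s', s = s' + 1 := Nat.exists_eq_succ_of_ne_zero (by omega)
      refine Nat.find_min hex (by omega : s' < Nat.find hex) ⟨by omega, ?_⟩
      rw [← hs', ← initialSegment_eq_iff]
      exact heq
  refine (hd _).trans ((add_le_add_left (hR _ _ _ hreq) _).trans (le_of_eq ?_))
  push_cast
  ring

/-! ### A non-computable set of bounded total cost -/

/-- The cost at stage `m` of a change at `x`, in multiples of `2 ^ (-m)`. -/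
def scaledCost (D : ℕ → Option (ℕ × ℕ)) (x m : ℕ) : ℕ :=
  ∑ t ∈ Finset.range m, (D t).elim 0 fun p => if x < p.2 then 2 ^ (m - p.1) else 0

/-- At stage `m`, the `e`-th requirement can diagonalize against the `e`-th computable function
cheaply, by changing the value at `Nat.pair e m.unpair.1` from `0` to `1`. -/
def CanAct (D : ℕ → Option (ℕ × ℕ)) (e m : ℕ) : Prop :=
  (Denumerable.ofNat Nat.Partrec.Code e).evaln m (Nat.pair e m.unpair.1) = some 0 ∧
    2 ^ e * scaledCost D (Nat.pair e m.unpair.1) m ≤ 2 ^ m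

/-- `m` is the first stage at which the `e`-th requirement can act. -/
def ActsAt (D : ℕ → Option (ℕ × ℕ)) (e m : ℕ) : Prop :=
  CanAct D e m ∧ ∀ m' < m, ¬ CanAct D e m'

/-- `x` is put into the diagonal set before stage `s`. -/
def DiagonalBefore (D : ℕ → Option (ℕ × ℕ)) (s x : ℕ) : Prop :=
  ∃ m < s, ActsAt D x.unpair.1 m ∧ m.unpair.1 = x.unpair.2

section Primrec

variable {D : ℕ → Option (ℕ × ℕ)}

theorem primrec_scaledCost (hD : Primrec D) :
    Primrec fun x : ℕ × ℕ => scaledCost D x.1 x.2 := by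
  have h : Primrec₂ fun (x : ℕ × ℕ) (t : ℕ) =>
      (D t).elim 0 fun p => if x.1 < p.2 then 2 ^ (x.2 - p.1) else 0 := by
    refine (Primrec.option_casesOn (o := fun y : (ℕ × ℕ) × ℕ => D y.2) (f := fun _ => 0)
      (g := fun y p => if y.1.1 < p.2 then 2 ^ (y.1.2 - p.1) else 0) (hD.comp Primrec.snd)
      (Primrec.const 0) ?_).of_eq fun y => ?_
    · have h1 : Primrec fun z : ((ℕ × ℕ) × ℕ) × ℕ × ℕ => z.1.1 := Primrec.fst.comp Primrec.fst
      exact Primrec.ite (Primrec.nat_lt.comp (Primrec.fst.comp h1) (Primrec.snd.comp Primrec.snd))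
        (Primrec.nat_pow.comp (Primrec.const 2)
          (Primrec.nat_sub.comp (Primrec.snd.comp h1) (Primrec.fst.comp Primrec.snd)))
        (Primrec.const 0)
    · dsimp only
      cases D y.2 <;> rfl
  exact (Primrec.sum_range h).comp Primrec.id Primrec.snd

theorem primrecRel_canAct (hD : Primrec D) : PrimrecRel (CanAct D) := by
  have hx : Primrec fun y : ℕ × ℕ => Nat.pair y.1 y.2.unpair.1 :=
    Primrec₂.natPair.comp Primrec.fst (Primrec.fst.comp (Primrec.unpair.comp Primrec.snd))
  refine PrimrecPred.and (Primrec.eq.comp (Nat.Partrec.Code.primrec_evaln.comp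
    ((Primrec.snd.pair ((Primrec.ofNat _).comp Primrec.fst)).pair hx)) (Primrec.const (some 0)))
    (Primrec.nat_le.comp (Primrec.nat_mul.comp
      (Primrec.nat_pow.comp (Primrec.const 2) Primrec.fst)
      ((primrec_scaledCost hD).comp (hx.pair Primrec.snd)))
      (Primrec.nat_pow.comp (Primrec.const 2) Primrec.snd))

theorem primrecRel_actsAt (hD : Primrec D) : PrimrecRel (ActsAt D) := by
  have h := primrecRel_canAct hD
  refine PrimrecPred.and h ?_
  have h' : PrimrecRel fun m' e => ¬ CanAct D e m' :=
    PrimrecPred.not (h.comp Primrec.snd Primrec.fst)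
  exact h'.forall_lt.comp Primrec.snd Primrec.fst

theorem primrecRel_diagonalBefore (hD : Primrec D) : PrimrecRel (DiagonalBefore D) := by
  have h : PrimrecRel fun m x : ℕ => ActsAt D x.unpair.1 m ∧ m.unpair.1 = x.unpair.2 :=
    PrimrecPred.and
      ((primrecRel_actsAt hD).comp (Primrec.fst.comp (Primrec.unpair.comp Primrec.snd)) Primrec.fst)
      (Primrec.eq.comp (Primrec.fst.comp (Primrec.unpair.comp Primrec.fst))
        (Primrec.snd.comp (Primrec.unpair.comp Primrec.snd)))
  exact h.exists_lt

end Primrec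

section Cost

variable {D : ℕ → Option (ℕ × ℕ)}

theorem scaledCost_eq (hD : ∀ t r n, D t = some (r, n) → r ≤ t) (x m : ℕ) :
    (scaledCost D x m : ℝ) = 2 ^ m * changeWeight D {x} m := by
  rw [scaledCost, changeWeight, Finset.mul_sum, Nat.cast_sum]
  refine Finset.sum_congr rfl fun t ht => ?_
  cases h : D t with
  | none => simp
  | some p =>
    have hp : p.1 ≤ m := (hD t p.1 p.2 h).trans (Finset.mem_range.1 ht).le
    by_cases hx : x < p.2
    · simp only [Option.elim, hx, if_true, Set.mem_singleton_iff, exists_eq_left]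
      rw [one_div, inv_pow, ← div_eq_mul_inv]
      push_cast
      rw [pow_sub₀ _ (by norm_num) hp, div_eq_mul_inv]
    · simp [hx]

theorem ActsAt.unique {e m m' : ℕ} (h : ActsAt D e m) (h' : ActsAt D e m') : m = m' :=
  le_antisymm (not_lt.1 fun hlt => h.2 _ hlt h'.1) (not_lt.1 fun hlt => h'.2 _ hlt h.1)

/-- A computation bounded by `m` only accepts arguments below `m`, and the witness codes `e`. Hence
only finitely many requirements matter up to a given stage. -/
theorem ActsAt.lt {e m : ℕ} (h : ActsAt D e m) : e < m :=
  (Nat.left_le_pair _ _).trans_lt (Nat.Partrec.Code.evaln_bound (Option.mem_def.2 h.1.1))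

theorem ActsAt.changeWeight_le (hD : ∀ t r n, D t = some (r, n) → r ≤ t) {e m : ℕ}
    (h : ActsAt D e m) : changeWeight D {Nat.pair e m.unpair.1} m ≤ (1 / 2) ^ e := by
  have h1 : (2 ^ e * scaledCost D (Nat.pair e m.unpair.1) m : ℝ) ≤ 2 ^ m := by
    exact_mod_cast h.1.2
  rw [scaledCost_eq hD] at h1
  have h2 : (2 : ℝ) ^ m * (2 ^ e * changeWeight D {Nat.pair e m.unpair.1} m) ≤ 2 ^ m * 1 := by
    linarith
  have h3 := le_of_mul_le_mul_left h2 (by positivity)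
  rw [one_div, inv_pow, ← one_div, le_div_iff₀ (by positivity)]
  linarith

theorem diagonalBefore_succ_iff {s x : ℕ} : DiagonalBefore D (s + 1) x ↔
    DiagonalBefore D s x ∨ (ActsAt D x.unpair.1 s ∧ s.unpair.1 = x.unpair.2) := by
  simp only [DiagonalBefore, Nat.lt_succ_iff_lt_or_eq, or_and_right, exists_or, exists_eq_left]

/-- Changes happen only when requirements act; each acts at most once, paying at most `2 ^ (-e)`,
and the geometric series sums to `2`. -/
theorem sum_changeWeight_diagonalBefore_le (hD : ∀ t r n, D t = some (r, n) → r ≤ t) (N : ℕ) :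
    ∑ s ∈ Finset.range N,
      changeWeight D {x | ¬ (DiagonalBefore D s x ↔ DiagonalBefore D (s + 1) x)} s ≤ 2 := by
  classical
  have h1 : ∀ s ∈ Finset.range N,
      changeWeight D {x | ¬ (DiagonalBefore D s x ↔ DiagonalBefore D (s + 1) x)} s ≤
      ∑ e ∈ Finset.range N, if ActsAt D e s then (1 / 2 : ℝ) ^ e else 0 := by
    intro s hs
    -- Several requirements may act at one stage; the weight of the union of their changes is at
    -- most the sum of the separate weights.
    have h2 : changeWeight D {x | ¬ (DiagonalBefore D s x ↔ DiagonalBefore D (s + 1) x)} s ≤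
        ∑ e ∈ Finset.range N, if ActsAt D e s then
          changeWeight D {Nat.pair e s.unpair.1} s else 0 := by
      simp only [← Finset.sum_filter]
      simp only [changeWeight]
      rw [Finset.sum_comm]
      refine Finset.sum_le_sum fun t _ => ?_
      cases D t with
      | none => simp
      | some p =>
        simp only [Option.elim, Set.mem_singleton_iff, exists_eq_left]
        split_ifs with hx
        · obtain ⟨x, hx, hlt⟩ := hx
          have hx' : ActsAt D x.unpair.1 s ∧ s.unpair.1 = x.unpair.2 := by
            rw [Set.mem_ofPred_eq, diagonalBefore_succ_iff] at hx
            tauto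
          have he : x.unpair.1 ∈ (Finset.range N).filter fun e => ActsAt D e s :=
            Finset.mem_filter.2 ⟨Finset.mem_range.2 (hx'.1.lt.trans (Finset.mem_range.1 hs)), hx'.1⟩
          refine le_trans ?_ (Finset.single_le_sum (f := fun e =>
            if Nat.pair e s.unpair.1 < p.2 then (1 / 2 : ℝ) ^ p.1 else 0) (fun e _ => ?_) he)
          · simp only [hx'.2, Nat.pair_unpair, hlt, if_true, le_refl]
          · split_ifs <;> positivity
        · exact Finset.sum_nonneg fun e _ => by split_ifs <;> positivity
    refine h2.trans (Finset.sum_le_sum fun e _ => ?_)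
    split_ifs with h
    · exact h.changeWeight_le hD
    · exact le_rfl
  refine (Finset.sum_le_sum h1).trans ?_
  rw [Finset.sum_comm]
  have h3 : ∀ e ∈ Finset.range N, (∑ s ∈ Finset.range N,
      if ActsAt D e s then (1 / 2 : ℝ) ^ e else 0) ≤ (1 / 2) ^ e := by
    intro e _
    rw [← Finset.sum_filter, Finset.sum_const, nsmul_eq_mul]
    have hc : ((Finset.range N).filter fun s => ActsAt D e s).card ≤ 1 :=
      Finset.card_le_one.2 fun s hs s' hs' =>
        (Finset.mem_filter.1 hs).2.unique (Finset.mem_filter.1 hs').2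
    have hc' : (((Finset.range N).filter fun s => ActsAt D e s).card : ℝ) ≤ 1 := by
      exact_mod_cast hc
    exact mul_le_of_le_one_left (by positivity) hc'
  exact (Finset.sum_le_sum h3).trans (sum_geometric_two_le N)

/-- The weights are summable, so outside a finite set of indices they contribute less than `ε`. An
`x` beyond all lengths in that finite set is charged only for the tail. -/
theorem exists_forall_changeWeight_le
    (hD : ∀ N, ∑ t ∈ Finset.range N, requestWeight (D t) ≤ 1) {ε : ℝ} (hε : 0 < ε) :
    ∃ k, ∀ x, k ≤ x → ∀ m, changeWeight D {x} m ≤ ε := by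
  classical
  have hs : Summable fun t => requestWeight (D t) :=
    summable_of_sum_range_le (fun t => requestWeight_nonneg _) hD
  obtain ⟨F, hF⟩ := summable_iff_vanishing_norm.1 hs ε hε
  refine ⟨F.sup fun t => (D t).elim 0 Prod.snd, fun x hx m => ?_⟩
  have h1 : changeWeight D {x} m ≤ ∑ t ∈ Finset.range m \ F, requestWeight (D t) := by
    rw [changeWeight, Finset.sdiff_eq_filter, Finset.sum_filter]
    refine Finset.sum_le_sum fun t _ => ?_
    by_cases ht : t ∈ F
    · have h2 : (D t).elim 0 Prod.snd ≤ x :=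
        (Finset.le_sup (f := fun t => (D t).elim 0 Prod.snd) ht).trans hx
      cases h : D t with
      | none => simp [ht]
      | some p =>
        rw [h] at h2
        change p.2 ≤ x at h2
        simp [ht, not_lt.2 h2]
    · cases h : D t with
      | none => simp [requestWeight]
      | some p =>
        simp only [Option.elim, ht, not_false_eq_true, if_true, requestWeight]
        split_ifs <;> simp
  refine h1.trans ((le_abs_self _).trans (hF _ Finset.sdiff_disjoint).le)

end Cost

theorem exists_not_computable_machineComplexity_initialSegment_le {U : List Bool →. List Bool}
    (hU : IsOptimalPrefixFreeMachine U) :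
    ∃ A : ℕ → Bool, ¬ Computable A ∧ ∃ b : ℕ, ∀ n, machineComplexity U (initialSegment A n) ≤
      machineComplexity U (List.replicate n false) + b := by
  classical
  obtain ⟨D, hD, hDt, hDw, hDU⟩ := hU.1.exists_primrec_enumeration
  refine ⟨fun x => decide (∃ s, DiagonalBefore D s x), fun hA => ?_,
    hU.machineComplexity_initialSegment_le hD hDw hDU
      (a := fun s x => decide (DiagonalBefore D s x)) ?_ ?_ ?_⟩
  · obtain ⟨c, hc⟩ := Nat.Partrec.Code.exists_code.1
      (Partrec.nat_iff.1 (Computable.encode.comp hA))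
    have hval : ∀ x, c.eval x =
        Part.some (encode (decide (∃ s, DiagonalBefore D s x))) := fun x => by rw [hc]; rfl
    set e := encode c with he
    have hce : Denumerable.ofNat Nat.Partrec.Code e = c := Denumerable.ofNat_encode c
    -- If the requirement acts, `c` outputs `0`, the code of `false`, at a number that is put into
    -- the set. Otherwise column `e` of the set is empty, so `c` outputs `0` on all of it, and a
    -- cheap witness there lets the requirement act after all.
    by_cases hex : ∃ m, CanAct D e m
    · have hm : ActsAt D e (Nat.find hex) := ⟨Nat.find_spec hex, fun _ h => Nat.find_min hex h⟩
      set m := Nat.find hex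
      have h1 := Nat.Partrec.Code.evaln_sound (Option.mem_def.2 hm.1.1)
      rw [hce, hval, Part.mem_some_iff] at h1
      have h2 : ∃ s, DiagonalBefore D s (Nat.pair e m.unpair.1) :=
        ⟨m + 1, m, Nat.lt_succ_self m, by simpa using hm, by simp⟩
      simp [h2] at h1
    · obtain ⟨k, hk⟩ := exists_forall_changeWeight_le hDw (ε := (1 / 2) ^ e) (by positivity)
      have h0 : ¬ ∃ s, DiagonalBefore D s (Nat.pair e k) := by
        rintro ⟨s, m, -, hm, -⟩
        rw [Nat.unpair_pair] at hm
        exact hex ⟨m, hm.1⟩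
      have h1 : 0 ∈ c.eval (Nat.pair e k) := by
        rw [hval]; simp [h0]
      obtain ⟨s, hs⟩ := Nat.Partrec.Code.evaln_complete.1 h1
      -- The stage encodes the witness index `k` and, being at least `s`, leaves enough steps for
      -- the computation.
      refine hex ⟨Nat.pair k s, ?_, ?_⟩
      · rw [hce, Nat.unpair_pair]
        exact Nat.Partrec.Code.evaln_mono (Nat.right_le_pair k s) hs
      · rw [Nat.unpair_pair]
        have h2 := hk (Nat.pair e k) (Nat.right_le_pair e k) (Nat.pair k s)
        rw [one_div, inv_pow, ← one_div, le_div_iff₀ (by positivity)] at h2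
        have h3 := scaledCost_eq hDt (Nat.pair e k) (Nat.pair k s)
        have h4 : (2 ^ e * scaledCost D (Nat.pair e k) (Nat.pair k s) : ℝ) ≤ 2 ^ Nat.pair k s := by
          rw [h3]
          have : (0 : ℝ) < 2 ^ Nat.pair k s := by positivity
          nlinarith
        exact_mod_cast h4
  · exact (primrecRel_iff_primrec_decide).1 (primrecRel_diagonalBefore hD)
  · simpa only [ne_eq, decide_eq_decide] using sum_changeWeight_diagonalBefore_le hDt
  · intro x
    by_cases hx : ∃ s, DiagonalBefore D s x
    · obtain ⟨s, m, hm, h⟩ := hx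
      filter_upwards [Filter.eventually_ge_atTop s] with s' hs'
      have h1 : DiagonalBefore D s' x := ⟨m, hm.trans_le hs', h⟩
      have h2 : ∃ s, DiagonalBefore D s x := ⟨s', h1⟩
      simp [h1, h2]
    · exact Filter.Eventually.of_forall fun s => by
        simp [hx, not_exists.1 hx s]

/-! ### Computable search and folds; invariance of `K`-triviality -/

theorem Computable.exists_choice {α : Type*} [Primcodable α] {P : α → ℕ → Bool}
    (hP : Computable₂ P) (h : ∀ a, ∃ n, P a n = true) :
    ∃ g : α → ℕ, Computable g ∧ ∀ a, P a (g a) = true := by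
  refine ⟨fun a => Nat.find (h a), ?_, fun a => Nat.find_spec (h a)⟩
  refine (Partrec.rfind (p := fun a n => Part.some (P a n)) hP).of_eq_tot fun a => ?_
  refine Nat.mem_rfind.2 ⟨Part.mem_some_iff.2 (Nat.find_spec (h a)).symm, fun {m} hm => ?_⟩
  have := Nat.find_min (h a) hm
  simpa using this

theorem Computable.list_foldl {β σ : Type*} [Primcodable β] [Primcodable σ] {h : σ → β → σ}
    (hh : Computable₂ h) (a : σ) : Computable fun l : List β => l.foldl h a := by
  have hstep : Computable₂ fun (l : List β) (x : ℕ × σ) =>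
      (l[x.1]?).elim x.2 (h x.2) := by
    refine (Computable.option_casesOn (o := fun y : List β × ℕ × σ => y.1[y.2.1]?)
      (f := fun y => y.2.2) (g := fun y b => h y.2.2 b)
      (Computable.list_getElem?.comp Computable.fst (Computable.fst.comp Computable.snd))
      (Computable.snd.comp Computable.snd)
      (hh.comp (Computable.snd.comp (Computable.snd.comp Computable.fst)) Computable.snd)).of_eq ?_
    intro y
    dsimp only
    cases y.1[y.2.1]? <;> rfl
  refine (Computable.nat_rec Computable.list_length (Computable.const a) hstep).of_eq fun l => ?_
  have key : ∀ n, (Nat.rec a (fun i s => (l[i]?).elim s (h s)) n : σ) = (l.take n).foldl h a := by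
    intro n
    induction n with
    | zero => rfl
    | succ n ih =>
      rw [List.take_add_one, List.foldl_append, ← ih]
      dsimp only
      cases l[n]? <;> rfl
  exact (key l.length).trans (by rw [List.take_length])

/-- Any two optimal machines give complexities that differ by at most a constant, so one machine
suffices. -/
theorem isKTrivialFunction_of_isOptimalPrefixFreeMachine {U : List Bool →. List Bool}
    (hU : IsOptimalPrefixFreeMachine U) {α : ℕ → ℕ} {b : ℕ}
    (h : ∀ n, machineComplexity U (tupleCode (initialSegment α n)) ≤
      machineComplexity U (List.replicate n false) + b) : IsKTrivialFunction α := by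
  intro V hV
  obtain ⟨d, hd⟩ := hV.2 U hU.1
  obtain ⟨d', hd'⟩ := hU.2 V hV.1
  refine ⟨d' + b + d, fun n => ?_⟩
  calc machineComplexity V (tupleCode (initialSegment α n))
      ≤ machineComplexity U (tupleCode (initialSegment α n)) + d := hd _
    _ ≤ machineComplexity V (List.replicate n false) + d' + b + d := by
      gcongr
      exact (h n).trans (by gcongr; exact hd' _)
    _ = _ := by push_cast; ring

theorem initialSegment_succ {β : Type*} (α : ℕ → β) (n : ℕ) :
    initialSegment α (n + 1) = initialSegment α n ++ [α n] := by
  simp [initialSegment, List.range_succ]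

/-! ### Branches of a Cantor scheme and their names -/

section CantorScheme

variable (g : ℕ × ℕ → ℕ × ℕ)

/-- One of the two children of the ball with centre `p.1` and radius `2 ^ (-p.2)` in the Cantor
scheme in which `g` yields the centre of the right child and the radius of both children. -/
def cantorChild (p : ℕ × ℕ) (b : Bool) : ℕ × ℕ := (bif b then (g p).1 else p.1, (g p).2)

/-- The balls along the branch `A` of the Cantor scheme given by `g`, starting from `p`. -/
def cantorPath (p : ℕ × ℕ) (A : ℕ → Bool) (n : ℕ) : ℕ × ℕ :=
  Nat.rec p (fun n r => cantorChild g r (A n)) n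

/-- The result of reading a bit in the transformation of a branch into the tuple of the centres
along that branch. -/
def cantorTransducer (s : List Bool × ℕ × ℕ) (b : Bool) : List Bool × ℕ × ℕ :=
  (s.1 ++ tupleCode [s.2.1], cantorChild g s.2 b)

variable {g}

theorem computable_cantorChild (hg : Computable g) : Computable₂ (cantorChild g) :=
  (Computable.cond Computable.snd (Computable.fst.comp (hg.comp Computable.fst))
    (Computable.fst.comp Computable.fst)).pair (Computable.snd.comp (hg.comp Computable.fst))

theorem primrec_tupleCode : Primrec tupleCode := by
  have h : Primrec fun n : ℕ => List.replicate n true :=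
    (Primrec.list_map Primrec.list_range (Primrec.const true).to₂).of_eq fun n => by simp
  exact Primrec.list_flatMap Primrec.id
    (Primrec.list_append.comp (h.comp Primrec.snd) (Primrec.const [false]))

theorem computable_cantorTransducer (hg : Computable g) : Computable₂ (cantorTransducer g) := by
  have h2 : Computable fun x : (List Bool × ℕ × ℕ) × Bool => x.1.2 :=
    Computable.snd.comp Computable.fst
  refine Computable.pair (Computable.list_append.comp (Computable.fst.comp Computable.fst) ?_)
    ((computable_cantorChild hg).comp h2 Computable.snd)
  exact primrec_tupleCode.to_comp.comp
    (Computable.list_cons.comp (Computable.fst.comp h2) (Computable.const []))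

/-- Each centre is written before its bit is read, so `n` bits yield exactly `n` centres. Thus the
coded initial segment of the name is a computable image of that of `A`, and its complexity grows by
only a constant. -/
theorem foldl_cantorTransducer (p : ℕ × ℕ) (A : ℕ → Bool) (n : ℕ) :
    (initialSegment A n).foldl (cantorTransducer g) ([], p) =
      (tupleCode (initialSegment (fun s => (cantorPath g p A s).1) n), cantorPath g p A n) := by
  induction n with
  | zero => rfl
  | succ n ih =>
    rw [initialSegment_succ, List.foldl_append, ih, initialSegment_succ]
    simp [cantorTransducer, tupleCode, cantorPath]

theorem isKTrivialFunction_cantorPath (hg : Computable g) (p : ℕ × ℕ) {U : List Bool →. List Bool}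
    (hU : IsOptimalPrefixFreeMachine U) {A : ℕ → Bool} {b : ℕ}
    (hA : ∀ n, machineComplexity U (initialSegment A n) ≤
      machineComplexity U (List.replicate n false) + b) :
    IsKTrivialFunction fun s => (cantorPath g p A s).1 := by
  obtain ⟨d, hd⟩ := hU.exists_machineComplexity_comp_le
    (Computable.fst.comp (Computable.list_foldl (computable_cantorTransducer hg) ([], p)))
  refine isKTrivialFunction_of_isOptimalPrefixFreeMachine hU (b := b + d) fun n => ?_
  have h := hd (initialSegment A n)
  simp only [foldl_cantorTransducer] at h
  refine h.trans ?_
  rw [Nat.cast_add, ← add_assoc]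
  gcongr
  exact hA n

end CantorScheme

/-! ### Splitting balls in a perfect computable metric space -/

section MetricSpaces

variable {M : Type*} [MetricSpace M] {q : ℕ → M}

theorem exists_special_point_near [PerfectSpace M] (hq : DenseRange q) (x : M) {ε : ℝ}
    (hε : 0 < ε) : ∃ j, 0 < dist x (q j) ∧ dist x (q j) < ε := by
  obtain ⟨y, hy, hyx⟩ := (accPt_iff_nhds.1
    (PerfectSpace.univ_preperfect x (Set.mem_univ x))) _ (Metric.ball_mem_nhds x hε)
  obtain ⟨j, hj⟩ := hq.exists_mem_open (Metric.isOpen_ball.sdiff isClosed_singleton)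
    ⟨y, hy.1, hyx⟩
  refine ⟨j, dist_pos.2 fun h => hj.2 h.symm, ?_⟩
  rw [dist_comm]
  exact hj.1

/-- `g` maps a ball, given by its centre `q p.1` and radius `2 ^ (-p.2)`, to another centre in it
and a radius such that the balls of that radius around both centres are far apart in the ball. -/
def IsSplitting (q : ℕ → M) (g : ℕ × ℕ → ℕ × ℕ) : Prop :=
  ∀ p, dist (q p.1) (q (g p).1) ≤ 1 / 2 ^ (p.2 + 1) ∧
    8 / 2 ^ (g p).2 ≤ dist (q p.1) (q (g p).1)

/-- If `a / 2 ^ n` is within `2 ^ (-n)` of a distance, this test ensures that the distance is at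
least `8 / 2 ^ n` and at most `2 ^ (-(k + 1))`. -/
def splitTest (a k n : ℕ) : Bool := decide (9 ≤ a ∧ (a + 1) * 2 ^ (k + 1) ≤ 2 ^ n)

theorem primrec_splitTest : Primrec fun x : ℕ × ℕ × ℕ => splitTest x.1 x.2.1 x.2.2 :=
  (PrimrecPred.and (Primrec.nat_le.comp (Primrec.const 9) Primrec.fst)
    (Primrec.nat_le.comp (Primrec.nat_mul.comp (Primrec.succ.comp Primrec.fst)
      (Primrec.nat_pow.comp (Primrec.const 2)
        (Primrec.succ.comp (Primrec.fst.comp Primrec.snd))))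
      (Primrec.nat_pow.comp (Primrec.const 2) (Primrec.snd.comp Primrec.snd)))).decide

/-- Search for a centre and a precision `n` passing a decidable test on the approximate distance;
the exponent `n` then also serves as that of the new radius. Perfectness and density make the search
terminate. -/
theorem IsComputableStructure.exists_isSplitting [PerfectSpace M] (hq : IsComputableStructure q) :
    ∃ g, Computable g ∧ IsSplitting q g := by
  obtain ⟨f, hf, hfq⟩ := hq.computable_dist
  let P : ℕ × ℕ → ℕ → Bool := fun p m =>
    splitTest (f (p.1, m.unpair.1, m.unpair.2)) p.2 m.unpair.2
  have hP : Computable₂ P := by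
    have h1 := primrec_splitTest.to_comp
    have hm1 : Computable fun x : (ℕ × ℕ) × ℕ => x.2.unpair.1 :=
      Computable.fst.comp (Computable.unpair.comp Computable.snd)
    have hm2 : Computable fun x : (ℕ × ℕ) × ℕ => x.2.unpair.2 :=
      Computable.snd.comp (Computable.unpair.comp Computable.snd)
    simp only [P]
    generalize splitTest = T at h1 ⊢
    exact h1.comp ((hf.comp
      ((Computable.fst.comp Computable.fst).pair (hm1.pair hm2))).pair
      ((Computable.snd.comp Computable.fst).pair hm2))
  have hex : ∀ p, ∃ m, P p m = true := by
    rintro ⟨j, k⟩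
    obtain ⟨j', h0, h1⟩ := exists_special_point_near hq.denseRange (q j)
      (show (0 : ℝ) < 1 / 2 ^ (k + 1) by positivity)
    set d := dist (q j) (q j')
    -- With numerator `a` within `1` of `d * 2 ^ n`, the first bound forces `a ≥ 9` and the second
    -- leaves room for `a + 1 ≤ d * 2 ^ n + 2` below `2 ^ n / 2 ^ (k + 1)`.
    obtain ⟨n, hn⟩ := pow_unbounded_of_one_lt
      (max (10 / d) (2 / (1 / 2 ^ (k + 1) - d))) (one_lt_two (α := ℝ))
    have h2 := (div_lt_iff₀ h0).1 ((le_max_left _ _).trans_lt hn)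
    have h3 := (div_lt_iff₀ (sub_pos.2 h1)).1 ((le_max_right _ _).trans_lt hn)
    have h4 := abs_le.1 (hfq j j' n)
    have hpos : (0 : ℝ) < 2 ^ n := by positivity
    refine ⟨Nat.pair j' n, decide_eq_true ?_⟩
    simp only [Nat.unpair_pair]
    have h5 : d * 2 ^ n ≤ f (j, j', n) + 1 := by
      have : d ≤ (f (j, j', n) + 1) / 2 ^ n := by rw [add_div]; linarith [h4.2]
      exact (le_div_iff₀ hpos).1 this
    have h6 : (f (j, j', n) : ℝ) ≤ d * 2 ^ n + 1 := by
      have : (f (j, j', n) : ℝ) / 2 ^ n ≤ d + 1 / 2 ^ n := by linarith [h4.1]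
      rw [div_le_iff₀ hpos, add_mul, one_div_mul_cancel hpos.ne'] at this
      exact this
    constructor
    · have : (9 : ℝ) ≤ f (j, j', n) := by linarith
      exact_mod_cast this
    · have : ((f (j, j', n) : ℝ) + 1) ≤ 2 ^ n / 2 ^ (k + 1) := by
        rw [mul_sub, mul_one_div] at h3
        linarith
      rw [le_div_iff₀ (by positivity)] at this
      exact_mod_cast this
  obtain ⟨g, hg, hgP⟩ := Computable.exists_choice hP hex
  refine ⟨fun p => (g p).unpair, Computable.unpair.comp hg, fun p => ?_⟩
  obtain ⟨h1, h2⟩ := of_decide_eq_true (hgP p)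
  dsimp only
  set j := (g p).unpair.1
  set n := (g p).unpair.2
  have hpos : (0 : ℝ) < 2 ^ n := by positivity
  have h4 := abs_le.1 (hfq p.1 j n)
  have h1' : (9 : ℝ) ≤ f (p.1, j, n) := by exact_mod_cast h1
  have h2' : ((f (p.1, j, n) : ℝ) + 1) * 2 ^ (p.2 + 1) ≤ 2 ^ n := by exact_mod_cast h2
  constructor
  · have h5 : ((f (p.1, j, n) : ℝ) + 1) / 2 ^ n ≤ 1 / 2 ^ (p.2 + 1) := by
      rw [div_le_div_iff₀ hpos (by positivity)]
      linarith
    rw [add_div] at h5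
    linarith [h4.2]
  · have h5 : (9 : ℝ) / 2 ^ n ≤ f (p.1, j, n) / 2 ^ n := by gcongr
    have h6 : (9 : ℝ) / 2 ^ n = 8 / 2 ^ n + 1 / 2 ^ n := by ring
    linarith [h4.1]

theorem IsCauchyName.dist_le {α : ℕ → ℕ} {x : M} (h : IsCauchyName q α x) (s : ℕ) :
    dist (q (α s)) x ≤ 1 / 2 ^ s :=
  le_of_tendsto (tendsto_const_nhds.dist h.2)
    (Filter.eventually_atTop.2 ⟨s, fun t ht => h.1 s t ht⟩)

section Splitting

variable {g : ℕ × ℕ → ℕ × ℕ}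

theorem IsSplitting.lt (hg : IsSplitting q g) (p : ℕ × ℕ) : p.2 < (g p).2 := by
  by_contra h
  have h1 := (hg p).2.trans (hg p).1
  rw [div_le_div_iff₀ (by positivity) (by positivity)] at h1
  have h2 : (2 : ℝ) ^ (g p).2 ≤ 2 ^ (p.2 + 1) :=
    pow_le_pow_right₀ one_le_two (by omega)
  have : (0 : ℝ) < 2 ^ (p.2 + 1) := by positivity
  linarith

theorem IsSplitting.le_cantorPath (hg : IsSplitting q g) (p : ℕ × ℕ) (A : ℕ → Bool) (n : ℕ) :
    n ≤ (cantorPath g p A n).2 := by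
  induction n with
  | zero => exact Nat.zero_le _
  | succ n ih => exact ih.trans_lt (hg.lt _)

/-- Nesting of the balls in a form suited to induction: one step moves the centre by at most half
the radius and at least halves the radius. -/
theorem IsSplitting.dist_cantorPath_add_le (hg : IsSplitting q g) (p : ℕ × ℕ) (A : ℕ → Bool)
    {m n : ℕ} (h : m ≤ n) :
    dist (q (cantorPath g p A m).1) (q (cantorPath g p A n).1) + 1 / 2 ^ (cantorPath g p A n).2 ≤
      1 / 2 ^ (cantorPath g p A m).2 := by
  induction n, h using Nat.le_induction with
  | base => simp
  | succ n h ih =>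
    refine le_trans ?_ ih
    set r := cantorPath g p A n
    have hr : cantorPath g p A (n + 1) = cantorChild g r (A n) := rfl
    rw [hr]
    have h1 : dist (q r.1) (q (cantorChild g r (A n)).1) ≤ 1 / 2 ^ (r.2 + 1) := by
      cases A n
      · simp [cantorChild]
      · exact (hg r).1
    have h2 : (1 : ℝ) / 2 ^ (cantorChild g r (A n)).2 ≤ 1 / 2 ^ (r.2 + 1) :=
      one_div_le_one_div_of_le (by positivity) (pow_le_pow_right₀ one_le_two (hg.lt r))
    have h3 : (1 : ℝ) / 2 ^ r.2 = 1 / 2 ^ (r.2 + 1) + 1 / 2 ^ (r.2 + 1) := by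
      rw [pow_succ]; ring
    have := dist_triangle (q (cantorPath g p A m).1) (q r.1) (q (cantorChild g r (A n)).1)
    linarith

theorem IsSplitting.exists_limit [CompleteSpace M] (hg : IsSplitting q g) (p : ℕ × ℕ)
    (A : ℕ → Bool) : ∃ x, IsCauchyName q (fun s => (cantorPath g p A s).1) x ∧
      ∀ n, dist (q (cantorPath g p A n).1) x ≤ 1 / 2 ^ (cantorPath g p A n).2 := by
  have h1 : ∀ s t, s ≤ t → dist (q (cantorPath g p A s).1) (q (cantorPath g p A t).1) ≤
      1 / 2 ^ (cantorPath g p A s).2 := fun s t hst =>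
    (le_add_of_nonneg_right (by positivity)).trans (hg.dist_cantorPath_add_le p A hst)
  have h2 : ∀ s t, s ≤ t → dist (q (cantorPath g p A s).1) (q (cantorPath g p A t).1) ≤
      1 / 2 ^ s := fun s t hst => (h1 s t hst).trans
    (one_div_le_one_div_of_le (by positivity)
      (pow_le_pow_right₀ one_le_two (hg.le_cantorPath p A s)))
  have h3 : CauchySeq fun s => q (cantorPath g p A s).1 := by
    refine cauchySeq_of_le_tendsto_0' (fun s : ℕ => (1 : ℝ) / 2 ^ s) h2 ?_
    simpa only [one_div, inv_pow] using
      tendsto_pow_atTop_nhds_zero_of_lt_one (r := (2⁻¹ : ℝ)) (by norm_num) (by norm_num)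
  obtain ⟨x, hx⟩ := cauchySeq_tendsto_of_complete h3
  exact ⟨x, ⟨h2, hx⟩, fun n => le_of_tendsto (tendsto_const_nhds.dist hx)
    (Filter.eventually_atTop.2 ⟨n, fun t ht => h1 n t ht⟩)⟩

/-- The two children of each ball are so far apart that an approximation of `x` tells which one
contains it; following the answers recovers the branch recursively. -/
theorem IsSplitting.computable_of_isComputablePoint (hg : IsSplitting q g) (hgc : Computable g)
    (hq : IsComputableStructure q) {p : ℕ × ℕ} {A : ℕ → Bool} {x : M}
    (hx : ∀ n, dist (q (cantorPath g p A n).1) x ≤ 1 / 2 ^ (cantorPath g p A n).2)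
    (hxc : IsComputablePoint q x) : Computable A := by
  obtain ⟨f, hf, hfq⟩ := hq.computable_dist
  obtain ⟨β, hβ, hβx⟩ := hxc
  -- In units of the child radius, the name, the child ball and the computed distance each
  -- contribute error at most `1`. The numerator is thus at most `3` on the left and at least `8 - 3
  -- = 5` on the right; `4` separates the cases.
  let bit : ℕ × ℕ → Bool := fun r => decide (4 ≤ f (β (g r).2, r.1, (g r).2))
  have hbit : Computable bit := by
    have h1 : Computable fun r : ℕ × ℕ => (g r).2 := Computable.snd.comp hgc
    have h2 : Primrec fun n : ℕ => decide (4 ≤ n) :=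
      (Primrec.nat_le.comp (Primrec.const 4) Primrec.id).decide
    exact h2.to_comp.comp (hf.comp ((hβ.comp h1).pair (Computable.fst.pair h1)))
  have hA : ∀ s, A s = bit (cantorPath g p A s) := by
    intro s
    have hs := hx (s + 1)
    have hr : cantorPath g p A (s + 1) = cantorChild g (cantorPath g p A s) (A s) := rfl
    rw [hr] at hs
    set r := cantorPath g p A s
    have h1 := hβx.dist_le (g r).2
    have h2 := abs_le.1 (hfq (β (g r).2) r.1 (g r).2)
    have h3 := (hg r).2
    simp only [bit]
    set n := (g r).2
    set u := q (β n)
    have hpos : (0 : ℝ) < 2 ^ n := by positivity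
    cases hAs : A s with
    | false =>
      rw [hAs] at hs
      have hs' : dist (q r.1) x ≤ 1 / 2 ^ n := hs
      have h4 : (f (β n, r.1, n) : ℝ) / 2 ^ n ≤ 3 / 2 ^ n := by
        have h5 : (3 : ℝ) / 2 ^ n = 1 / 2 ^ n + 1 / 2 ^ n + 1 / 2 ^ n := by ring
        have := dist_triangle_right u (q r.1) x
        linarith [h2.1]
      rw [div_le_div_iff_of_pos_right hpos] at h4
      have h6 : f (β n, r.1, n) ≤ 3 := by exact_mod_cast h4
      simp; omega
    | true =>
      rw [hAs] at hs
      have hs' : dist (q (g r).1) x ≤ 1 / 2 ^ n := hs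
      have h4 : (5 : ℝ) / 2 ^ n ≤ f (β n, r.1, n) / 2 ^ n := by
        have h5 : (8 : ℝ) / 2 ^ n = 5 / 2 ^ n + 1 / 2 ^ n + 1 / 2 ^ n + 1 / 2 ^ n := by ring
        have e1 := dist_triangle (q r.1) u (q (g r).1)
        have e2 := dist_triangle_right u (q (g r).1) x
        rw [dist_comm (q r.1) u] at e1
        linarith [h2.2]
      rw [div_le_div_iff_of_pos_right hpos] at h4
      have h6 : 5 ≤ f (β n, r.1, n) := by exact_mod_cast h4
      simp; omega
  -- The decoded bit replaces `A n` in the recursion, so the path is computed without reference to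
  -- `A`.
  have hpath : Computable (cantorPath g p A) := by
    have hstep : Computable fun r => cantorChild g r (bit r) :=
      (computable_cantorChild hgc).comp Computable.id hbit
    refine (Computable.nat_rec (f := id) (g := fun _ : ℕ => p)
      (h := fun _ y => cantorChild g y.2 (bit y.2)) Computable.id (Computable.const p)
      (hstep.comp (Computable.snd.comp Computable.snd))).of_eq fun n => ?_
    induction n with
    | zero => rfl
    | succ n ih =>
      have hr : cantorPath g p A (n + 1) = cantorChild g (cantorPath g p A n) (A n) := rfl
      rw [hr, hA n, ← ih]
      rfl
  exact (hbit.comp hpath).of_eq fun n => (hA n).symm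

end Splitting

end MetricSpaces

theorem mainTheorem9 {M : Type*} [MetricSpace M] [CompleteSpace M] [PerfectSpace M]
    (q : ℕ → M) (hq : IsComputableStructure q) (i : ℕ) (δ : ℚ) (hδ : 0 < δ) :
    ∃ x ∈ Metric.ball (q i) (δ : ℝ), ¬ IsComputablePoint q x ∧ IsKTrivialPoint q x := by
  obtain ⟨U, hU⟩ := exists_isOptimalPrefixFreeMachine
  obtain ⟨A, hA, b, hb⟩ := exists_not_computable_machineComplexity_initialSegment_le hU
  obtain ⟨g, hgc, hg⟩ := hq.exists_isSplitting
  -- The root ball has radius `2 ^ (-k) < δ`, so the limit of every branch lies in the open ball.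
  obtain ⟨k, hk⟩ := exists_pow_lt_of_lt_one (show (0 : ℝ) < δ by exact_mod_cast hδ)
    (show (1 / 2 : ℝ) < 1 by norm_num)
  obtain ⟨x, hx, hdist⟩ := hg.exists_limit (i, k) A
  refine ⟨x, ?_, fun hxc => hA (hg.computable_of_isComputablePoint hgc hq hdist hxc),
    _, isKTrivialFunction_cantorPath hgc (i, k) hU hb, hx⟩
  rw [Metric.mem_ball, dist_comm]
  refine (hdist 0).trans_lt ?_
  rwa [one_div_pow] at hk
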